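/- Let $K$ be a field and let $\Lambda \subset \mathbb{N}^d$ be a standard bigraded semigroup, i.e. a finitely generated subsemigroup containing $0$ that is a disjoint union $\Lambda = \bigcup_{i,j \ge 0} \Lambda_{(i,j)}$ with $\Lambda_{(0,0)} = \{0\}$ and $\Lambda_{(i,j)} + \Lambda_{(k,l)} \subset \Lambda_{(i+k,j+l)}$ for all $i,j,k,l\ge 0$, and that is generated by $\Lambda_{(1,0)} \cup \Lambda_{(0,1)}$. Order $\Lambda$ by divisibility: $\mu \preceq \lambda$ if and only if $\lambda = \sigma + \mu$ for some $\sigma \in \Lambda$. For $\lambda \in \Lambda$ let $\Gamma_\lambda$ be the order complex of the open interval $(0,\lambda) = \{\sigma \in \Lambda : 0 \prec \sigma \prec \lambda\}$, i.e. the simplicial complex whose faces are the totally ordered subsets of $(0,\lambda)$. Let $a,b \ge 0$ be integers with $(a,b) \ne (0,0)$ and put $$\Lambda_\Delta = \bigcup_{i \ge 0} \Lambda_{(ia,ib)}, \qquad \Lambda_{\tilde\Delta} = \bigcup_{i,j \ge 0} \Lambda_{(ia,jb)},$$ both with the order induced from $\Lambda$. For $\lambda \in \Lambda_\Delta$ let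 $(\Gamma_\lambda)_\Delta$ be the order complex of the open interval $(0,\lambda) \cap \Lambda_\Delta$, and for $\lambda \in \Lambda_{\tilde\Delta}$ let $(\Gamma_\lambda)_{\tilde\Delta}$ be the order complex of $(0,\lambda) \cap \Lambda_{\tilde\Delta}$. A finite simplicial complex $\Gamma$ is called Cohen–Macaulay (over $K$) if for every face $F$ of $\Gamma$ (including $F = \emptyset$) the reduced simplicial homology $\tilde H_i(\mathrm{lk}_\Gamma F; K)$ vanishes for all $i < \dim \mathrm{lk}_\Gamma F$. If $\Gamma_\lambda$ is Cohen–Macaulay over $K$ for all $\lambda \in \Lambda$, then 1. $(\Gamma_\lambda)_\Delta$ is Cohen–Macaulay over $K$ for all $\lambda \in \Lambda_\Delta$; 2. $(\Gamma_\lambda)_{\tilde\Delta}$ is Cohen–Macaulay over $K$ for all $\lambda \in \Lambda_{\tilde\Delta}$. -/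

import Mathlib

/-! ### Simplicial complexes, links, reduced simplicial homology, Cohen-Macaulayness

A simplicial complex is a `PreAbstractSimplicialComplex`: Mathlib lists only its nonempty faces, and
here the empty set always counts as a face too. So the complex without nonempty faces is the complex
`{∅}`, of dimension `-1`. -/

open scoped Classical in
/-- The link of `F` in `Γ`: the `G` disjoint from `F` such that `G ∪ F` is a face. -/
def simplicialLink {V : Type*} (Γ : PreAbstractSimplicialComplex V) (F : Finset V) :
    PreAbstractSimplicialComplex V where
  faces := {G | G.Nonempty ∧ Disjoint G F ∧ G ∪ F ∈ Γ}
  isRelLowerSet_faces := by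
    rintro G ⟨hne, hdisj, hmem⟩
    refine ⟨hne, fun H hHG hH => ⟨hH, hdisj.mono_left hHG, ?_⟩⟩
    exact (Γ.isRelLowerSet_faces hmem).2 (Finset.union_subset_union_left hHG)
      (hH.mono Finset.subset_union_left)

/-- Simplicial chains of `Γ` with coefficients in `K` on the faces with `n` vertices, that is, of
dimension `n - 1`. For `n = 0` this is the one-dimensional space spanned by the empty face. -/
def simplicialChains (K : Type*) [Field K] {V : Type*} (Γ : PreAbstractSimplicialComplex V)
    (n : ℕ) : Submodule K (Finset V →₀ K) :=
  Finsupp.supported K K {F | F.card = n ∧ (F ∈ Γ ∨ F = ∅)}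

open scoped Classical in
/-- The (augmented) simplicial boundary map. The vertices are listed according to a fixed linear
order, which is chosen to extend the given partial order; a vertex `x` of `F` preceded by `k`
vertices of `F` contributes `(-1) ^ k • (F \ {x})` to the boundary of `F`. -/
noncomputable def simplicialBoundary (K : Type*) [Field K] (V : Type*) [PartialOrder V] :
    (Finset V →₀ K) →ₗ[K] (Finset V →₀ K) :=
  Finsupp.linearCombination K fun F : Finset V =>
    ∑ x ∈ F, Finsupp.single (F.erase x)
      ((-1 : K) ^ (F.filter fun y => toLinearExtension y < toLinearExtension x).card)

/-- Reduced cycles of dimension `n - 1`. -/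
noncomputable def reducedCycles (K : Type*) [Field K] {V : Type*} [PartialOrder V]
    (Γ : PreAbstractSimplicialComplex V) (n : ℕ) : Submodule K (Finset V →₀ K) :=
  simplicialChains K Γ n ⊓ LinearMap.ker (simplicialBoundary K V)

/-- Reduced boundaries of dimension `n - 1`. -/
noncomputable def reducedBoundaries (K : Type*) [Field K] {V : Type*} [PartialOrder V]
    (Γ : PreAbstractSimplicialComplex V) (n : ℕ) : Submodule K (Finset V →₀ K) :=
  (simplicialChains K Γ (n + 1)).map (simplicialBoundary K V)

/-- The reduced simplicial homology of `Γ` over `K` vanishes in dimension `n - 1`: every reduced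
cycle is a reduced boundary. -/
def ReducedHomologyVanishes (K : Type*) [Field K] {V : Type*} [PartialOrder V]
    (Γ : PreAbstractSimplicialComplex V) (n : ℕ) : Prop :=
  reducedCycles K Γ n ≤ reducedBoundaries K Γ n

/-- `Γ` is Cohen-Macaulay over `K`: for every face `F`, the empty one included, the reduced
homology of the link of `F` vanishes in all dimensions smaller than the dimension of the link.
The inequality `n - 1 < dim` says that some face of the link has more than `n` vertices. -/
def IsCohenMacaulayComplex (K : Type*) [Field K] {V : Type*} [PartialOrder V]
    (Γ : PreAbstractSimplicialComplex V) : Prop :=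
  ∀ F : Finset V, (F ∈ Γ ∨ F = ∅) →
    ∀ n : ℕ, (∃ G ∈ simplicialLink Γ F, n < G.card) →
      ReducedHomologyVanishes K (simplicialLink Γ F) n

/-- The order complex of a subset `S` of a poset, with the induced order: its faces are the finite
totally ordered subsets of `S`. -/
def subsetOrderComplex {P : Type*} [PartialOrder P] (S : Set P) :
    PreAbstractSimplicialComplex P where
  faces := {F | F.Nonempty ∧ (F : Set P) ⊆ S ∧ IsChain (· ≤ ·) (F : Set P)}
  isRelLowerSet_faces := by
    rintro F ⟨hne, hS, hF⟩
    refine ⟨hne, fun G hGF hG => ⟨hG, ?_, ?_⟩⟩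
    · exact (Finset.coe_subset.2 hGF).trans hS
    · exact hF.mono (Finset.coe_subset.2 hGF)

/-! ### Standard bigraded semigroups -/

/-- A standard bigraded (finitely generated, affine) semigroup in `ℕ ^ d`. It contains `0`, because
its component of degree `(0, 0)` is `{0}`. -/
structure StandardBigradedSemigroup (d : ℕ) where
  /-- the underlying semigroup -/
  toAddSubmonoid : AddSubmonoid (Fin d → ℕ)
  fg : toAddSubmonoid.FG
  /-- the set of elements of degree `(i, j)` -/
  component : ℕ → ℕ → Set (Fin d → ℕ)
  iUnion_component : (⋃ i, ⋃ j, component i j) = (toAddSubmonoid : Set (Fin d → ℕ))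
  disjoint_component : ∀ i j k l : ℕ, (i, j) ≠ (k, l) →
    Disjoint (component i j) (component k l)
  component_zero_zero : component 0 0 = {0}
  add_mem_component : ∀ (i j k l : ℕ) (x y : Fin d → ℕ), x ∈ component i j →
    y ∈ component k l → x + y ∈ component (i + k) (j + l)
  closure_component : AddSubmonoid.closure (component 1 0 ∪ component 0 1) = toAddSubmonoid

namespace StandardBigradedSemigroup

/-- The elements of the semigroup. This type carries the divisibility order, not the componentwise
order of `ℕ ^ d`. -/
def Elem {d : ℕ} (Λ : StandardBigradedSemigroup d) : Type :=
  {x : Fin d → ℕ // x ∈ Λ.toAddSubmonoid}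

instance {d : ℕ} (Λ : StandardBigradedSemigroup d) : Zero Λ.Elem :=
  ⟨⟨0, Λ.toAddSubmonoid.zero_mem⟩⟩

/-- The divisibility order: `μ ≤ ν` if `ν = σ + μ` for some element `σ` of the semigroup. -/
instance {d : ℕ} (Λ : StandardBigradedSemigroup d) : PartialOrder Λ.Elem where
  le μ ν := ∃ σ ∈ Λ.toAddSubmonoid, ν.1 = σ + μ.1
  le_refl μ := ⟨0, Λ.toAddSubmonoid.zero_mem, (zero_add _).symm⟩
  le_trans := by
    rintro μ ν ρ ⟨σ, hσ, h⟩ ⟨τ, hτ, h'⟩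
    exact ⟨τ + σ, Λ.toAddSubmonoid.add_mem hτ hσ, by rw [h', h, add_assoc]⟩
  le_antisymm := by
    rintro μ ν ⟨σ, -, h⟩ ⟨τ, -, h'⟩
    apply Subtype.ext
    funext i
    have h1 := congrFun h i
    have h2 := congrFun h' i
    simp only [Pi.add_apply] at h1 h2
    omega

/-- The `(a, b)`-diagonal: the union of the components of degree `(i * a, i * b)`. -/
def diagonal {d : ℕ} (Λ : StandardBigradedSemigroup d) (a b : ℕ) : Set Λ.Elem :=
  {x | ∃ i : ℕ, x.1 ∈ Λ.component (i * a) (i * b)}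

/-- The generalized Veronese semigroup: the union of the components of degree `(i * a, j * b)`. -/
def veronese {d : ℕ} (Λ : StandardBigradedSemigroup d) (a b : ℕ) : Set Λ.Elem :=
  {x | ∃ i j : ℕ, x.1 ∈ Λ.component (i * a) (j * b)}

end StandardBigradedSemigroup

/-! Write |x| for the total degree. Since the semigroup is generated in total degree one, (0, x)
contains chains with |x| - 1 elements, so the hypothesis makes its homology vanish below dimension
|x| - 2, which is `AcyclicBelow` with bound |x| - 1. By translation the same holds for (y, x), with
|x| - |y| in place of |x|. Both subsemigroups are treated at once, as the elements whose bidegree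
lies in a `DegreeSelection`; its function m takes over the role of the total degree.

The unselected elements of (0, x) are deleted one by one in increasing order. When y is deleted, its
link is the join of the selected part of (0, y) with the interval (y, x). A deletion preserves
vanishing wherever the homology of the link vanishes (`AcyclicBelow.diff_singleton`), and vanishing
ranges add up under joins (`AcyclicBelow.union`). This gives an induction on |x|
(`acyclicBelow_carrier`), in which an unselected x needs the bound m(x), one more than the bound
m(x) - 1 for a selected x.

The extra unit comes from starting, for unselected x, with {y ∈ (0, x) | e y < e x} instead of (0,
x). Here e is an entry of the bidegree that is strictly smaller than e x on all selected elements
below x. Vanishing passes from (0, x) to this subset because the chains of the subset form a retract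
(`AcyclicBelow.sep_degree_lt`). Indeed, chains in (0, x) are words of nonzero letters with sum x,
the boundary becomes the bar differential, and the subset corresponds to the words whose first
letter has nonzero e. The retraction takes the initial letters with e = 0, reverses them and
shuffles them, with signs, into the letters behind the first letter with e ≠ 0. Commutativity makes
this a chain map.

Finally, the link of a chain in a selected interval is a join of translated selected intervals, and
m is additive on selected bidegrees, so the ranges add up to what Cohen–Macaulayness asks for
(`isCohenMacaulayComplex_carrier`). -/

open Finset in
open scoped Classical in
/-- The sign with which a vertex `x` enters the simplicial boundary of `F`. -/
noncomputable def vertexSign (K : Type*) [Field K] {P : Type*} [PartialOrder P]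
    (x : P) (F : Finset P) : K :=
  (-1 : K) ^ (F.filter fun y => toLinearExtension y < toLinearExtension x).card

/-! ### The simplicial boundary and cones -/

section Boundary

open scoped Classical

variable {K : Type*} [Field K] {P : Type*} [PartialOrder P]

theorem toLinearExtension_ne {x y : P} (h : x ≠ y) :
    toLinearExtension x ≠ toLinearExtension y := fun h' => h h'

theorem vertexSign_mul_self (x : P) (F : Finset P) :
    vertexSign K x F * vertexSign K x F = 1 := by
  unfold vertexSign
  rw [← pow_add, ← two_mul, pow_mul]
  simp

theorem vertexSign_insert_self {y : P} {G : Finset P} :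
    vertexSign K y (insert y G) = vertexSign K y G := by
  unfold vertexSign
  rw [Finset.filter_insert, if_neg (lt_irrefl _)]

theorem vertexSign_insert {x y : P} {G : Finset P} (hy : y ∉ G) :
    vertexSign K x (insert y G) =
      (if toLinearExtension y < toLinearExtension x then -1 else 1) * vertexSign K x G := by
  unfold vertexSign
  rw [Finset.filter_insert]
  split_ifs with h
  · rw [Finset.card_insert_of_notMem (by simp [hy]), pow_succ, mul_comm]
  · simp

/-- Exactly one of x and y precedes the other in the linear extension, so exactly one of the two
signs notices the presence of the other vertex. -/
theorem vertexSign_exchange {x y : P} {G : Finset P} (hy : y ∉ G) (hx : x ∈ G) :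
    vertexSign K y G * vertexSign K x (insert y G) =
      -(vertexSign K x G * vertexSign K y (G.erase x)) := by
  have hxy : x ≠ y := fun h => hy (h ▸ hx)
  rw [vertexSign_insert hy]
  nth_rewrite 1 [← Finset.insert_erase hx]
  rw [vertexSign_insert (Finset.notMem_erase x G)]
  rcases lt_or_gt_of_ne (toLinearExtension_ne hxy) with h | h
  · rw [if_pos h, if_neg h.not_gt]; ring
  · rw [if_neg h.not_gt, if_pos h]; ring

theorem simplicialBoundary_single (F : Finset P) :
    simplicialBoundary K P (Finsupp.single F 1) =
      ∑ x ∈ F, Finsupp.single (F.erase x) (vertexSign K x F) := by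
  simp [simplicialBoundary, Finsupp.linearCombination_single, vertexSign]

/-- The signed cone with apex `y`, which kills the simplices that already contain `y`. -/
noncomputable def simplicialCone (K : Type*) [Field K] {P : Type*} [PartialOrder P] (y : P) :
    (Finset P →₀ K) →ₗ[K] (Finset P →₀ K) :=
  Finsupp.linearCombination K fun G : Finset P =>
    if y ∈ G then 0 else Finsupp.single (insert y G) (vertexSign K y G)

theorem simplicialCone_single {y : P} {G : Finset P} (hy : y ∉ G) (c : K) :
    simplicialCone K y (Finsupp.single G c) =
      Finsupp.single (insert y G) (c * vertexSign K y G) := by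
  simp [simplicialCone, Finsupp.linearCombination_single, hy]

theorem simplicialBoundary_cone_single {y : P} {G : Finset P} (hy : y ∉ G) :
    simplicialBoundary K P (simplicialCone K y (Finsupp.single G 1)) =
      Finsupp.single G 1 -
        simplicialCone K y (simplicialBoundary K P (Finsupp.single G 1)) := by
  have h1 : simplicialCone K y (Finsupp.single G 1) =
      vertexSign K y G • Finsupp.single (insert y G) (1 : K) := by
    rw [simplicialCone_single hy, Finsupp.smul_single]; simp
  rw [h1, map_smul, simplicialBoundary_single, simplicialBoundary_single, Finset.sum_insert hy,
    Finset.erase_insert hy, smul_add, Finsupp.smul_single, vertexSign_insert_self, smul_eq_mul,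
    vertexSign_mul_self, sub_eq_add_neg, map_sum, Finset.smul_sum, ← Finset.sum_neg_distrib]
  congr 1
  refine Finset.sum_congr rfl fun x hx => ?_
  have hxy : y ≠ x := fun h => hy (h ▸ hx)
  rw [simplicialCone_single (fun h => hy (Finset.mem_of_mem_erase h)),
    Finset.erase_insert_of_ne hxy, Finsupp.smul_single, smul_eq_mul, vertexSign_exchange hy hx,
    Finsupp.single_neg]

/-- An equality of linear maps holds on a space of chains as soon as it holds on simplices. -/
theorem LinearMap.eq_of_mem_supported {α N : Type*} [AddCommGroup N] [Module K N]
    {f g : (α →₀ K) →ₗ[K] N} {s : Set α}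
    (h : ∀ a ∈ s, f (Finsupp.single a 1) = g (Finsupp.single a 1)) {c : α →₀ K}
    (hc : c ∈ Finsupp.supported K K s) : f c = g c := by
  rw [Finsupp.supported_eq_span_single] at hc
  refine LinearMap.eqOn_span (f := f) (g := g) ?_ hc
  rintro _ ⟨a, ha, rfl⟩
  exact h a ha

/-- A linear map sends a space of chains to a submodule as soon as it sends simplices there. -/
theorem LinearMap.mem_of_mem_supported {α N : Type*} [AddCommGroup N] [Module K N]
    {f : (α →₀ K) →ₗ[K] N} {s : Set α} {q : Submodule K N}
    (h : ∀ a ∈ s, f (Finsupp.single a 1) ∈ q) {c : α →₀ K}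
    (hc : c ∈ Finsupp.supported K K s) : f c ∈ q := by
  rw [Finsupp.supported_eq_span_single] at hc
  have : Submodule.span K ((fun i => Finsupp.single i (1 : K)) '' s) ≤ q.comap f := by
    rw [Submodule.span_le]
    rintro _ ⟨a, ha, rfl⟩
    exact h a ha
  exact this hc

/-- Omitting the apex gives back the chain, and omitting another vertex gives the cone over a face
with opposite sign by `vertexSign_exchange`. Away from y, the cone is thus a contracting homotopy.
-/
theorem simplicialBoundary_cone {y : P} {c : Finset P →₀ K}
    (hc : c ∈ Finsupp.supported K K {F : Finset P | y ∉ F}) :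
    simplicialBoundary K P (simplicialCone K y c) =
      c - simplicialCone K y (simplicialBoundary K P c) := by
  refine LinearMap.eq_of_mem_supported (f := simplicialBoundary K P ∘ₗ simplicialCone K y)
    (g := LinearMap.id - simplicialCone K y ∘ₗ simplicialBoundary K P) ?_ hc
  intro F hF
  exact simplicialBoundary_cone_single hF

theorem simplicialBoundary_mem_supported {s : Set (Finset P)} {t : Set (Finset P)}
    (h : ∀ F ∈ s, ∀ x ∈ F, F.erase x ∈ t) {c : Finset P →₀ K}
    (hc : c ∈ Finsupp.supported K K s) :
    simplicialBoundary K P c ∈ Finsupp.supported K K t := by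
  refine LinearMap.mem_of_mem_supported (fun F hF => ?_) hc
  rw [simplicialBoundary_single]
  exact Submodule.sum_mem _ fun x hx => Finsupp.single_mem_supported K _ (h F hF x hx)

/-- Every nonempty simplex is, up to sign, a cone over a smaller one, so the cone formula applied
twice reduces the claim to the base of the cone. -/
theorem simplicialBoundary_comp_self (c : Finset P →₀ K) :
    simplicialBoundary K P (simplicialBoundary K P c) = 0 := by
  have key : ∀ F : Finset P,
      simplicialBoundary K P (simplicialBoundary K P (Finsupp.single F 1)) = 0 := by
    intro F
    induction F using Finset.induction_on with
    | empty => simp [simplicialBoundary_single]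
    | insert y G hy ih =>
      have h1 : Finsupp.single (insert y G) (1 : K) =
          vertexSign K y G • simplicialCone K y (Finsupp.single G 1) := by
        rw [simplicialCone_single hy, Finsupp.smul_single, one_mul, smul_eq_mul,
          vertexSign_mul_self]
      have h2 : simplicialBoundary K P (Finsupp.single G 1) ∈
          Finsupp.supported K K {F : Finset P | y ∉ F} :=
        simplicialBoundary_mem_supported (s := {G})
          (by rintro F rfl x hx h; exact hy (Finset.mem_of_mem_erase h))
          (Finsupp.single_mem_supported K _ rfl)
      rw [h1, map_smul, map_smul, simplicialBoundary_cone_single hy, map_sub,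
        simplicialBoundary_cone h2, ih]
      simp
  exact LinearMap.eq_of_mem_supported
    (f := simplicialBoundary K P ∘ₗ simplicialBoundary K P) (g := 0) (s := Set.univ)
    (fun F _ => key F) (by simp)

end Boundary

/-! ### Acyclicity ranges of order complexes and deletion of an element -/

section OrderComplex

open scoped Classical

variable {K : Type*} [Field K] {P : Type*} [PartialOrder P]

/-- The chains of `P` with `n` elements that are contained in `S`. -/
def chainsOfCard {P : Type*} [PartialOrder P] (S : Set P) (n : ℕ) : Set (Finset P) :=
  {F | F.card = n ∧ (F : Set P) ⊆ S ∧ IsChain (· ≤ ·) (F : Set P)}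

theorem simplicialChains_subsetOrderComplex (S : Set P) (n : ℕ) :
    simplicialChains K (subsetOrderComplex S) n =
      Finsupp.supported K K (chainsOfCard S n) := by
  unfold simplicialChains
  congr 1
  ext F
  constructor
  · rintro ⟨h, hF | rfl⟩
    · exact ⟨h, hF.2⟩
    · exact ⟨h, by simp, by simp⟩
  · rintro ⟨h, hF⟩
    refine ⟨h, ?_⟩
    rcases F.eq_empty_or_nonempty with rfl | hne
    · exact Or.inr rfl
    · exact Or.inl ⟨hne, hF⟩

/-- The reduced homology of the order complex of `S` vanishes in all dimensions below `k - 1`. -/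
def AcyclicBelow (K : Type*) [Field K] {P : Type*} [PartialOrder P] (S : Set P) (k : ℕ) : Prop :=
  ∀ n < k, ReducedHomologyVanishes K (subsetOrderComplex S) n

theorem acyclicBelow_iff {S : Set P} {k : ℕ} : AcyclicBelow K S k ↔
    ∀ n < k, ∀ c ∈ Finsupp.supported K K (chainsOfCard S n), simplicialBoundary K P c = 0 →
      ∃ w ∈ Finsupp.supported K K (chainsOfCard S (n + 1)), simplicialBoundary K P w = c := by
  unfold AcyclicBelow ReducedHomologyVanishes reducedCycles reducedBoundaries
  simp only [simplicialChains_subsetOrderComplex, SetLike.le_def, Submodule.mem_inf,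
    LinearMap.mem_ker, Submodule.mem_map, and_imp]

theorem AcyclicBelow.mono {S : Set P} {k l : ℕ} (h : AcyclicBelow K S k) (hl : l ≤ k) :
    AcyclicBelow K S l := fun n hn => h n (hn.trans_le hl)

theorem chainsOfCard_mono {S T : Set P} (h : S ⊆ T) (n : ℕ) :
    chainsOfCard S n ⊆ chainsOfCard T n := fun _ hF => ⟨hF.1, hF.2.1.trans h, hF.2.2⟩

theorem erase_mem_chainsOfCard {S : Set P} {n : ℕ} {F : Finset P}
    (hF : F ∈ chainsOfCard S (n + 1)) {x : P} (hx : x ∈ F) : F.erase x ∈ chainsOfCard S n := by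
  refine ⟨by rw [Finset.card_erase_of_mem hx, hF.1]; rfl, ?_, ?_⟩
  · exact (Finset.coe_subset.2 (Finset.erase_subset x F)).trans hF.2.1
  · exact hF.2.2.mono (Finset.coe_subset.2 (Finset.erase_subset x F))

theorem simplicialBoundary_mem_chains {S : Set P} {n : ℕ} {c : Finset P →₀ K}
    (hc : c ∈ Finsupp.supported K K (chainsOfCard S (n + 1))) :
    simplicialBoundary K P c ∈ Finsupp.supported K K (chainsOfCard S n) :=
  simplicialBoundary_mem_supported (fun _ hF _ hx => erase_mem_chainsOfCard hF hx) hc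

/-- Removing an element keeps homology zero in a range in which the homology of its link is
zero. -/
theorem AcyclicBelow.diff_singleton {S : Set P} {y : P} {k : ℕ} (hS : AcyclicBelow K S k)
    (hy : y ∈ S) (hl : AcyclicBelow K {z ∈ S | z < y ∨ y < z} k) :
    AcyclicBelow K (S \ {y}) k := by
  rw [acyclicBelow_iff] at *
  intro n hn c hc hc0
  set L : Set P := {z ∈ S | z < y ∨ y < z} with hL
  have hLS : L ⊆ S \ {y} := by
    rintro z ⟨hz, h⟩
    exact ⟨hz, by rintro rfl; exact h.elim (lt_irrefl _) (lt_irrefl _)⟩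
  have hoff : ∀ m, Finsupp.supported K K (chainsOfCard (S \ {y}) m) ≤
      Finsupp.supported K K {F : Finset P | y ∉ F} := fun m =>
    Finsupp.supported_mono fun F hF h => (hF.2.1 h).2 rfl
  obtain ⟨w, hw, rfl⟩ := hS n hn c
    (Finsupp.supported_mono (chainsOfCard_mono Set.sdiff_subset n) hc) hc0
  -- Sorting simplices by whether they contain y writes w as w0 plus the cone over a chain w1 of the
  -- link of y.
  have hdec : Finsupp.supported K K (chainsOfCard S (n + 1)) ≤
      Finsupp.supported K K (chainsOfCard (S \ {y}) (n + 1)) ⊔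
        (Finsupp.supported K K (chainsOfCard L n)).map (simplicialCone K y) := by
    rw [Finsupp.supported_eq_span_single K (chainsOfCard S (n + 1)), Submodule.span_le]
    rintro _ ⟨F, hF, rfl⟩
    by_cases hyF : y ∈ F
    · refine Submodule.mem_sup_right ⟨Finsupp.single (F.erase y) (vertexSign K y (F.erase y)),
        Finsupp.single_mem_supported K _ ?_, ?_⟩
      · have := erase_mem_chainsOfCard hF hyF
        refine ⟨this.1, fun z hz => ⟨this.2.1 hz, ?_⟩, this.2.2⟩
        have hz' := Finset.mem_erase.1 (Finset.mem_coe.1 hz)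
        rcases hF.2.2.total hz'.2 hyF with h | h
        · exact Or.inl (lt_of_le_of_ne h hz'.1)
        · exact Or.inr (lt_of_le_of_ne h (Ne.symm hz'.1))
      · rw [simplicialCone_single (Finset.notMem_erase y F), vertexSign_mul_self,
          Finset.insert_erase hyF]
    · refine Submodule.mem_sup_left (Finsupp.single_mem_supported K _
        ⟨hF.1, fun z hz => ⟨hF.2.1 hz, ?_⟩, hF.2.2⟩)
      rintro rfl
      exact hyF hz
  obtain ⟨w0, hw0, _, ⟨w1, hw1, rfl⟩, rfl⟩ := Submodule.mem_sup.1 (hdec hw)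
  have hw1' : w1 ∈ Finsupp.supported K K {F : Finset P | y ∉ F} :=
    hoff n (Finsupp.supported_mono (chainsOfCard_mono hLS n) hw1)
  have hdw1 : simplicialBoundary K P w1 ∈ Finsupp.supported K K {F : Finset P | y ∉ F} :=
    simplicialBoundary_mem_supported (s := {F : Finset P | y ∉ F}) (t := {F : Finset P | y ∉ F})
      (fun F hF x _ h => hF (Finset.mem_of_mem_erase h)) hw1'
  rw [map_add, simplicialBoundary_cone hw1'] at hc
  -- All other terms of the boundary of w avoid y, while every simplex of this cone contains y.
  have hcone : simplicialCone K y (simplicialBoundary K P w1) = 0 := by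
    have h1 : simplicialCone K y (simplicialBoundary K P w1) ∈
        Finsupp.supported K K {F : Finset P | y ∉ F} := by
      have h2 := Submodule.sub_mem _ (Submodule.add_mem _
        (hoff n (simplicialBoundary_mem_chains hw0))
        hw1') (hoff n hc)
      convert h2 using 1
      abel
    have h3 : simplicialCone K y (simplicialBoundary K P w1) ∈
        Finsupp.supported K K {F : Finset P | y ∈ F} := by
      refine LinearMap.mem_of_mem_supported (fun F hF => ?_) hdw1
      rw [simplicialCone_single hF]
      exact Finsupp.single_mem_supported K _ (Finset.mem_insert_self y F)
    have h4 : Disjoint {F : Finset P | y ∉ F} {F : Finset P | y ∈ F} :=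
      Set.disjoint_left.2 fun F h h' => h h'
    exact (Submodule.disjoint_def.1 (Finsupp.disjoint_supported_supported h4)) _ h1 h3
  -- The boundary of the vanishing cone over ∂w1 is ∂w1 itself, since ∂∂w1 = 0.
  have hw1z : simplicialBoundary K P w1 = 0 := by
    have := simplicialBoundary_cone hdw1
    rw [hcone, map_zero, simplicialBoundary_comp_self, map_zero, sub_zero] at this
    exact this.symm
  obtain ⟨u, hu, hu'⟩ := hl n hn w1 hw1 hw1z
  -- Now c = ∂w0 + w1, and u fills the cycle w1 inside the link, hence without using y.
  refine ⟨w0 + u, Submodule.add_mem _ hw0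
    (Finsupp.supported_mono (chainsOfCard_mono hLS _) hu), ?_⟩
  rw [map_add, map_add, hu', simplicialBoundary_cone hw1', hcone, sub_zero]

end OrderComplex

/-- A linear map restricted to a subspace has a section with values in the subspace. -/
theorem Submodule.exists_section_on {K V W : Type*} [Field K] [AddCommGroup V] [Module K V]
    [AddCommGroup W] [Module K W] (C : Submodule K V) (f : V →ₗ[K] W) :
    ∃ t : W →ₗ[K] V, (∀ w, t w ∈ C) ∧ ∀ c ∈ C, f (t (f c)) = f c := by
  let f' : C →ₗ[K] W := f ∘ₗ C.subtype
  obtain ⟨g, hg⟩ := LinearMap.exists_rightInverse_of_surjective f'.rangeRestrict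
    f'.range_rangeRestrict
  obtain ⟨g', hg'⟩ := LinearMap.exists_extend g
  refine ⟨C.subtype ∘ₗ g', fun c => (g' c).2, fun c hc => ?_⟩
  have h1 : g' (f c) = g (f'.rangeRestrict ⟨c, hc⟩) := by
    rw [← hg']; rfl
  have h2 : f'.rangeRestrict (g (f'.rangeRestrict ⟨c, hc⟩)) = f'.rangeRestrict ⟨c, hc⟩ :=
    LinearMap.congr_fun hg _
  rw [LinearMap.comp_apply, h1]
  exact congrArg Subtype.val h2

/-! ### Joins and the Künneth range -/

section Join

open scoped Classical

variable {K : Type*} [Field K] {P : Type*} [PartialOrder P]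

/-- A complex that is acyclic below `k` has a contracting homotopy in this range. -/
theorem AcyclicBelow.exists_homotopy {S : Set P} {k : ℕ} (hS : AcyclicBelow K S k) :
    ∃ h : (Finset P →₀ K) →ₗ[K] (Finset P →₀ K),
      (∀ n, ∀ c ∈ Finsupp.supported K K (chainsOfCard S n),
        h c ∈ Finsupp.supported K K (chainsOfCard S (n + 1))) ∧
      ∀ n < k, ∀ c ∈ Finsupp.supported K K (chainsOfCard S n),
        simplicialBoundary K P (h c) + h (simplicialBoundary K P c) = c := by
  rw [acyclicBelow_iff] at hS
  have ht : ∀ n, ∃ t : (Finset P →₀ K) →ₗ[K] (Finset P →₀ K),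
      (∀ c, t c ∈ Finsupp.supported K K (chainsOfCard S n)) ∧
      ∀ c ∈ Finsupp.supported K K (chainsOfCard S n),
        simplicialBoundary K P (t (simplicialBoundary K P c)) = simplicialBoundary K P c :=
    fun n => Submodule.exists_section_on _ _
  choose t htm htb using ht
  -- With t n a partial inverse of ∂ on n-vertex chains, c - t n (∂c) is a cycle, hence a boundary
  -- in the given range; t (n + 1) chooses a filling of it linearly.
  let h : (Finset P →₀ K) →ₗ[K] (Finset P →₀ K) := Finsupp.linearCombination K fun F =>
    if F.card < k then
      t (F.card + 1) (Finsupp.single F 1 -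
        t F.card (simplicialBoundary K P (Finsupp.single F 1))) else 0
  have h1 : ∀ n < k, ∀ c ∈ Finsupp.supported K K (chainsOfCard S n),
      h c = t (n + 1) (c - t n (simplicialBoundary K P c)) := by
    intro n hn c hc
    refine LinearMap.eq_of_mem_supported (f := h)
      (g := t (n + 1) ∘ₗ (LinearMap.id - t n ∘ₗ simplicialBoundary K P)) ?_ hc
    rintro F ⟨rfl, -⟩
    simp [h, Finsupp.linearCombination_single, hn]
  refine ⟨h, fun n c hc => ?_, fun n hn c hc => ?_⟩
  · refine LinearMap.mem_of_mem_supported (fun F hF => ?_) hc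
    simp only [h, Finsupp.linearCombination_single, one_smul]
    split_ifs
    · have := htm (F.card + 1) (Finsupp.single F 1 -
        t F.card (simplicialBoundary K P (Finsupp.single F 1)))
      rwa [hF.1] at this ⊢
    · exact Submodule.zero_mem _
  · have he : c - t n (simplicialBoundary K P c) ∈ Finsupp.supported K K (chainsOfCard S n) :=
      Submodule.sub_mem _ hc (htm n _)
    obtain ⟨w, hw, hw'⟩ := hS n hn _ he (by rw [map_sub, htb n c hc, sub_self])
    have h2 : simplicialBoundary K P (h c) = c - t n (simplicialBoundary K P c) := by
      rw [h1 n hn c hc, ← hw', htb _ w hw]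
    have h3 : h (simplicialBoundary K P c) = t n (simplicialBoundary K P c) := by
      cases n with
      | zero =>
        have : simplicialBoundary K P c = 0 := by
          refine LinearMap.eq_of_mem_supported (g := 0) (fun F hF => ?_) hc
          rw [Finset.card_eq_zero.1 hF.1, simplicialBoundary_single]
          simp
        rw [this, map_zero, map_zero]
      | succ m =>
        rw [h1 m (by omega) _ (simplicialBoundary_mem_chains hc), simplicialBoundary_comp_self,
          map_zero, sub_zero]
    rw [h2, h3, sub_add_cancel]

/-- The bilinear extension of the union of finite sets to chains. -/
noncomputable def chainUnion (K : Type*) [Field K] (P : Type*) :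
    (Finset P →₀ K) →ₗ[K] (Finset P →₀ K) →ₗ[K] (Finset P →₀ K) :=
  Finsupp.linearCombination K fun F : Finset P => Finsupp.lmapDomain K K (F ∪ ·)

theorem chainUnion_single {P : Type*} (F G : Finset P) (c d : K) :
    chainUnion K P (Finsupp.single F c) (Finsupp.single G d) =
      Finsupp.single (F ∪ G) (c * d) := by
  simp [chainUnion, Finsupp.linearCombination_single]

/-- Bilinear maps that agree on simplices agree on chains. -/
theorem LinearMap.eq_of_mem_supported₂ {α β N : Type*} [AddCommGroup N] [Module K N]
    {f g : (α →₀ K) →ₗ[K] (β →₀ K) →ₗ[K] N} {s : Set α} {t : Set β}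
    (h : ∀ a ∈ s, ∀ b ∈ t, f (Finsupp.single a 1) (Finsupp.single b 1) =
      g (Finsupp.single a 1) (Finsupp.single b 1)) {c : α →₀ K} {d : β →₀ K}
    (hc : c ∈ Finsupp.supported K K s) (hd : d ∈ Finsupp.supported K K t) : f c d = g c d := by
  refine LinearMap.eq_of_mem_supported (f := f.flip d) (g := g.flip d) (fun a ha => ?_) hc
  exact LinearMap.eq_of_mem_supported (fun b hb => h a ha b hb) hd

theorem vertexSign_union_left {A B : Set P} (hAB : ∀ a ∈ A, ∀ b ∈ B, a < b) {F G : Finset P}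
    (hF : (F : Set P) ⊆ A) (hG : (G : Set P) ⊆ B) {x : P} (hx : x ∈ F) :
    vertexSign K x (F ∪ G) = vertexSign K x F := by
  unfold vertexSign
  rw [Finset.filter_union, Finset.filter_eq_empty_iff (s := G).2, Finset.union_empty]
  intro y hy
  exact not_lt.2 (toLinearExtension.monotone (hAB x (hF hx) y (hG hy)).le)

theorem vertexSign_union_right {A B : Set P} (hAB : ∀ a ∈ A, ∀ b ∈ B, a < b) {F G : Finset P}
    (hF : (F : Set P) ⊆ A) (hG : (G : Set P) ⊆ B) {x : P} (hx : x ∈ G) :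
    vertexSign K x (F ∪ G) = (-1) ^ F.card * vertexSign K x G := by
  unfold vertexSign
  rw [Finset.filter_union, Finset.card_union_of_disjoint, pow_add, Finset.filter_true_of_mem]
  · intro y hy
    have := hAB y (hF hy) x (hG hx)
    exact lt_of_le_of_ne (toLinearExtension.monotone this.le) (toLinearExtension_ne this.ne)
  · refine (Finset.disjoint_left.2 fun y hy hy' => ?_).mono (Finset.filter_subset _ _)
      (Finset.filter_subset _ _)
    exact (hAB y (hF hy) y (hG hy')).ne rfl

/-- The Leibniz rule for joins. The chosen linear order extends the partial order, so all vertices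
from A come first and each vertex from B is shifted by p places. -/
theorem simplicialBoundary_chainUnion {A B : Set P} (hAB : ∀ a ∈ A, ∀ b ∈ B, a < b) {p : ℕ}
    {a b : Finset P →₀ K} {q : ℕ} (ha : a ∈ Finsupp.supported K K (chainsOfCard A p))
    (hb : b ∈ Finsupp.supported K K (chainsOfCard B q)) :
    simplicialBoundary K P (chainUnion K P a b) =
      chainUnion K P (simplicialBoundary K P a) b +
        (-1 : K) ^ p • chainUnion K P a (simplicialBoundary K P b) := by
  suffices h : ∀ F ∈ chainsOfCard A p, ∀ G ∈ chainsOfCard B q,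
      (chainUnion K P).compr₂ (simplicialBoundary K P) (Finsupp.single F 1) (Finsupp.single G 1) =
      (chainUnion K P ∘ₗ simplicialBoundary K P +
        (-1 : K) ^ p • (chainUnion K P).compl₂ (simplicialBoundary K P))
          (Finsupp.single F 1) (Finsupp.single G 1) by
    have := LinearMap.eq_of_mem_supported₂ h ha hb
    simpa only [LinearMap.compr₂_apply, LinearMap.add_apply, LinearMap.comp_apply,
      LinearMap.smul_apply, LinearMap.compl₂_apply] using this
  intro F hF G hG
  have hdisj : Disjoint F G := Finset.disjoint_left.2 fun y hy hy' =>
    (hAB y (hF.2.1 hy) y (hG.2.1 hy')).ne rfl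
  simp only [LinearMap.compr₂_apply, LinearMap.add_apply, LinearMap.comp_apply,
    LinearMap.smul_apply, LinearMap.compl₂_apply, chainUnion_single, mul_one]
  rw [simplicialBoundary_single, simplicialBoundary_single, simplicialBoundary_single,
    Finset.sum_union hdisj, map_sum, map_sum, LinearMap.sum_apply, Finset.smul_sum]
  congr 1
  · refine Finset.sum_congr rfl fun x hx => ?_
    rw [chainUnion_single, mul_one, vertexSign_union_left hAB hF.2.1 hG.2.1 hx,
      Finset.erase_union_distrib, Finset.erase_eq_of_notMem (Finset.disjoint_left.1 hdisj hx)]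
  · refine Finset.sum_congr rfl fun x hx => ?_
    rw [chainUnion_single, one_mul, vertexSign_union_right hAB hF.2.1 hG.2.1 hx,
      Finset.erase_union_distrib, Finset.erase_eq_of_notMem (Finset.disjoint_right.1 hdisj hx),
      Finsupp.smul_single, hF.1, smul_eq_mul]

theorem union_mem_chainsOfCard {A B : Set P} (hAB : ∀ a ∈ A, ∀ b ∈ B, a < b) {F G : Finset P}
    {p q : ℕ} (hF : F ∈ chainsOfCard A p) (hG : G ∈ chainsOfCard B q) :
    F ∪ G ∈ chainsOfCard (A ∪ B) (p + q) := by
  have hdisj : Disjoint F G := Finset.disjoint_left.2 fun y hy hy' =>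
    (hAB y (hF.2.1 hy) y (hG.2.1 hy')).ne rfl
  refine ⟨by rw [Finset.card_union_of_disjoint hdisj, hF.1, hG.1], ?_, ?_⟩
  · rw [Finset.coe_union]; exact Set.union_subset_union hF.2.1 hG.2.1
  · rw [Finset.coe_union, isChain_union]
    exact ⟨hF.2.2, hG.2.2, fun x hx y hy _ => Or.inl (hAB x (hF.2.1 hx) y (hG.2.1 hy)).le⟩

theorem chainUnion_mem_chains {A B : Set P} (hAB : ∀ a ∈ A, ∀ b ∈ B, a < b) {p q : ℕ}
    {a b : Finset P →₀ K} (ha : a ∈ Finsupp.supported K K (chainsOfCard A p))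
    (hb : b ∈ Finsupp.supported K K (chainsOfCard B q)) :
    chainUnion K P a b ∈ Finsupp.supported K K (chainsOfCard (A ∪ B) (p + q)) := by
  rw [← LinearMap.flip_apply]
  refine LinearMap.mem_of_mem_supported (fun F hF => ?_) ha
  rw [LinearMap.flip_apply]
  refine LinearMap.mem_of_mem_supported (fun G hG => ?_) hb
  rw [chainUnion_single]
  exact Finsupp.single_mem_supported K _ (union_mem_chainsOfCard hAB hF hG)

theorem filter_mem_chainsOfCard {A B : Set P} {F : Finset P} {n : ℕ}
    (hF : F ∈ chainsOfCard (A ∪ B) n) :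
    F.filter (· ∈ A) ∈ chainsOfCard A (F.filter (· ∈ A)).card := by
  refine ⟨rfl, fun x hx => (Finset.mem_filter.1 (Finset.mem_coe.1 hx)).2, ?_⟩
  exact hF.2.2.mono (Finset.coe_subset.2 (Finset.filter_subset _ _))

/-- A linear map that acts on the two parts of a simplex of a join separately. -/
theorem exists_chainUnion_map {A B : Set P} (hAB : ∀ a ∈ A, ∀ b ∈ B, a < b)
    (f g : (Finset P →₀ K) →ₗ[K] (Finset P →₀ K)) :
    ∃ H : (Finset P →₀ K) →ₗ[K] (Finset P →₀ K), ∀ p q, ∀ a b : Finset P →₀ K,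
      a ∈ Finsupp.supported K K (chainsOfCard A p) →
      b ∈ Finsupp.supported K K (chainsOfCard B q) →
      H (chainUnion K P a b) = chainUnion K P (f a) (g b) := by
  refine ⟨Finsupp.linearCombination K fun F => chainUnion K P
    (f (Finsupp.single (F.filter (· ∈ A)) 1)) (g (Finsupp.single (F.filter (· ∈ B)) 1)), ?_⟩
  intro p q a b ha hb
  set H : (Finset P →₀ K) →ₗ[K] (Finset P →₀ K) :=
    Finsupp.linearCombination K fun F => chainUnion K P
      (f (Finsupp.single (F.filter (· ∈ A)) 1)) (g (Finsupp.single (F.filter (· ∈ B)) 1)) with hHdef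
  suffices h : ∀ F ∈ chainsOfCard A p, ∀ G ∈ chainsOfCard B q,
      (chainUnion K P).compr₂ H (Finsupp.single F 1) (Finsupp.single G 1) =
        (chainUnion K P).compl₁₂ f g (Finsupp.single F 1) (Finsupp.single G 1) by
    have := LinearMap.eq_of_mem_supported₂ h ha hb
    simpa only [LinearMap.compr₂_apply, LinearMap.compl₁₂_apply] using this
  intro F hF G hG
  have h1 : (F ∪ G).filter (· ∈ A) = F := by
    rw [Finset.filter_union, Finset.filter_true_of_mem (fun x hx => hF.2.1 hx),
      Finset.filter_false_of_mem (s := G) (fun x hx hx' => (hAB x hx' x (hG.2.1 hx)).ne rfl),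
      Finset.union_empty]
  have h2 : (F ∪ G).filter (· ∈ B) = G := by
    rw [Finset.filter_union, Finset.filter_true_of_mem (s := G) (fun x hx => hG.2.1 hx),
      Finset.filter_false_of_mem (s := F) (fun x hx hx' => (hAB x (hF.2.1 hx) x hx').ne rfl),
      Finset.empty_union]
  simp only [LinearMap.compr₂_apply, LinearMap.compl₁₂_apply, chainUnion_single, mul_one,
    hHdef, Finsupp.linearCombination_single, one_smul, h1, h2]

/-- The part of the vanishing of the homology of a join that the Künneth formula gives. -/
theorem AcyclicBelow.union {A B : Set P} {k l : ℕ} (hA : AcyclicBelow K A k)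
    (hB : AcyclicBelow K B l) (hAB : ∀ a ∈ A, ∀ b ∈ B, a < b) :
    AcyclicBelow K (A ∪ B) (k + l) := by
  obtain ⟨f, hfm, hf⟩ := hA.exists_homotopy
  obtain ⟨g, hgm, hg⟩ := hB.exists_homotopy
  -- The homotopies used on the join are f ⊗ 1 and, with the sign (-1) ^ p from τ, 1 ⊗ g; the sign
  -- makes the mixed terms of the second one cancel.
  let τ : (Finset P →₀ K) →ₗ[K] (Finset P →₀ K) :=
    Finsupp.linearCombination K fun F => Finsupp.single F ((-1 : K) ^ F.card)
  have hτ : ∀ p, ∀ a ∈ Finsupp.supported K K (chainsOfCard A p), τ a = (-1 : K) ^ p • a := by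
    intro p a ha
    refine LinearMap.eq_of_mem_supported (f := τ) (g := (-1 : K) ^ p • LinearMap.id)
      (fun F hF => ?_) ha
    simp [τ, Finsupp.linearCombination_single, hF.1]
  obtain ⟨H, hH⟩ := exists_chainUnion_map (K := K) hAB f LinearMap.id
  simp only [LinearMap.id_apply] at hH
  obtain ⟨G, hG⟩ := exists_chainUnion_map (K := K) hAB τ g
  rw [acyclicBelow_iff]
  intro n hn c hc hc0
  set D := simplicialBoundary K P with hD
  have hDU : ∀ p q, ∀ a b : Finset P →₀ K, a ∈ Finsupp.supported K K (chainsOfCard A p) →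
      b ∈ Finsupp.supported K K (chainsOfCard B q) →
      D (chainUnion K P a b) = chainUnion K P (D a) b + (-1 : K) ^ p • chainUnion K P a (D b) :=
    fun p q a b ha hb => simplicialBoundary_chainUnion hAB ha hb
  have hDA : ∀ p, ∀ a ∈ Finsupp.supported K K (chainsOfCard A p), D a = 0 ∨
      ∃ p', p = p' + 1 ∧ D a ∈ Finsupp.supported K K (chainsOfCard A p') := by
    intro p a ha
    cases p with
    | zero =>
      left
      refine LinearMap.eq_of_mem_supported (g := 0) (fun F hF => ?_) ha
      rw [Finset.card_eq_zero.1 hF.1, simplicialBoundary_single]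
      simp
    | succ m => exact Or.inr ⟨m, rfl, simplicialBoundary_mem_chains ha⟩
  have hDB : ∀ q, ∀ b ∈ Finsupp.supported K K (chainsOfCard B q), ∃ q',
      D b ∈ Finsupp.supported K K (chainsOfCard B q') := by
    intro q b hb
    cases q with
    | zero =>
      refine ⟨0, ?_⟩
      have : D b = 0 := by
        refine LinearMap.eq_of_mem_supported (g := 0) (fun F hF => ?_) hb
        rw [Finset.card_eq_zero.1 hF.1, simplicialBoundary_single]
        simp
      rw [this]
      exact Submodule.zero_mem _
    | succ m => exact ⟨m, simplicialBoundary_mem_chains hb⟩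
  -- The mixed terms f a ⊗ ∂b cancel, because f raises the number of vertices by one and so flips
  -- the sign in the Leibniz rule.
  have hHU : ∀ p q, ∀ a b : Finset P →₀ K, a ∈ Finsupp.supported K K (chainsOfCard A p) →
      b ∈ Finsupp.supported K K (chainsOfCard B q) →
      D (H (chainUnion K P a b)) + H (D (chainUnion K P a b)) =
        chainUnion K P (D (f a) + f (D a)) b := by
    intro p q a b ha hb
    obtain ⟨q', hb'⟩ := hDB q b hb
    have h1 : H (chainUnion K P (D a) b) = chainUnion K P (f (D a)) b := by
      rcases hDA p a ha with h | ⟨p', rfl, h⟩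
      · simp [h]
      · exact hH _ _ _ _ h hb
    rw [hH p q a b ha hb, hDU _ _ _ _ (hfm p a ha) hb, hDU _ _ _ _ ha hb,
      map_add, map_smul, h1, hH p q' a _ ha hb', map_add,
      LinearMap.add_apply, pow_succ]
    simp only [mul_neg, mul_one, neg_smul]
    abel
  have hGU : ∀ p q, q < l → ∀ a b : Finset P →₀ K,
      a ∈ Finsupp.supported K K (chainsOfCard A p) →
      b ∈ Finsupp.supported K K (chainsOfCard B q) →
      D (G (chainUnion K P a b)) + G (D (chainUnion K P a b)) = chainUnion K P a b := by
    intro p q hq a b ha hb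
    obtain ⟨q', hb'⟩ := hDB q b hb
    have h1 : G (chainUnion K P (D a) b) = -((-1 : K) ^ p • chainUnion K P (D a) (g b)) := by
      rcases hDA p a ha with h | ⟨p', rfl, h⟩
      · simp [h]
      · rw [hG _ _ _ _ h hb, hτ p' _ h, pow_succ]
        simp
    have h2 : ((-1 : K) ^ p) * (-1 : K) ^ p = 1 := by
      rw [← pow_add, ← two_mul, pow_mul]; simp
    rw [hG p q a b ha hb, hτ p a ha, map_smul, LinearMap.smul_apply, map_smul,
      hDU _ _ _ _ ha (hgm q b hb), hDU _ _ _ _ ha hb, map_add, map_smul, h1,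
      hG p q' a _ ha hb', hτ p a ha,
      map_smul, LinearMap.smul_apply, smul_add, smul_smul, smul_smul, h2, one_smul, one_smul]
    have h3 : chainUnion K P a (D (g b)) + chainUnion K P a (g (D b)) = chainUnion K P a b := by
      rw [← map_add, hg q hq b hb]
    rw [← h3]
    abel
  have hsplit : ∀ F ∈ chainsOfCard (A ∪ B) n, ∃ p q, p + q = n ∧ ∃ F₁ ∈ chainsOfCard A p,
      ∃ F₂ ∈ chainsOfCard B q,
        Finsupp.single F (1 : K) = chainUnion K P (Finsupp.single F₁ 1) (Finsupp.single F₂ 1) := by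
    intro F hF
    have hF1 := filter_mem_chainsOfCard hF
    have hF2 := filter_mem_chainsOfCard (A := B) (B := A) (by rwa [Set.union_comm])
    have hu : F.filter (· ∈ A) ∪ F.filter (· ∈ B) = F := by
      rw [← Finset.filter_or, Finset.filter_true_of_mem]
      exact fun x hx => hF.2.1 hx
    refine ⟨_, _, ?_, _, hF1, _, hF2, ?_⟩
    · have := (union_mem_chainsOfCard hAB hF1 hF2).1
      rw [hu, hF.1] at this
      exact this.symm
    · rw [chainUnion_single, hu, mul_one]
  let N : Submodule K (Finset P →₀ K) := Submodule.span K
    {x | ∃ p q, p + q = n ∧ q < l ∧ ∃ a ∈ Finsupp.supported K K (chainsOfCard A p),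
      ∃ b ∈ Finsupp.supported K K (chainsOfCard B q), x = chainUnion K P a b}
  -- On components with p < k the first homotopy is exact and leaves nothing. The others have p ≥ k,
  -- so n < k + l forces q < l, where the second homotopy works.
  have hE : c - (D (H c) + H (D c)) ∈ N := by
    refine LinearMap.mem_of_mem_supported (f := LinearMap.id - (D ∘ₗ H + H ∘ₗ D))
      (fun F hF => ?_) hc
    obtain ⟨p, q, hpq, F₁, hF₁, F₂, hF₂, e⟩ := hsplit F hF
    have m1 := Finsupp.single_mem_supported K (1 : K) hF₁
    have m2 := Finsupp.single_mem_supported K (1 : K) hF₂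
    simp only [LinearMap.sub_apply, LinearMap.add_apply, LinearMap.comp_apply, LinearMap.id_apply]
    rw [e, hHU p q _ _ m1 m2]
    by_cases hp : p < k
    · rw [hf p hp _ m1, sub_self]
      exact Submodule.zero_mem _
    · refine Submodule.subset_span ⟨p, q, hpq, by omega, Finsupp.single F₁ 1 -
        (D (f (Finsupp.single F₁ 1)) + f (D (Finsupp.single F₁ 1))), ?_, _, m2, ?_⟩
      · refine Submodule.sub_mem _ m1 (Submodule.add_mem _
          (simplicialBoundary_mem_chains (hfm p _ m1)) ?_)
        rcases hDA p _ m1 with h | ⟨p', rfl, h⟩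
        · rw [h, map_zero]; exact Submodule.zero_mem _
        · exact hfm p' _ h
      · rw [map_sub, LinearMap.sub_apply]
  have hN : ∀ z ∈ N, D (G z) + G (D z) = z ∧
      G z ∈ Finsupp.supported K K (chainsOfCard (A ∪ B) (n + 1)) := by
    intro z hz
    refine Submodule.span_induction ?_ ?_ ?_ ?_ hz
    · rintro _ ⟨p, q, hpq, hq, a, ha, b, hb, rfl⟩
      refine ⟨hGU p q hq a b ha hb, ?_⟩
      rw [hG p q a b ha hb, hτ p a ha, map_smul, LinearMap.smul_apply]
      rw [← hpq, add_assoc]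
      exact Submodule.smul_mem _ _ (chainUnion_mem_chains hAB ha (hgm q b hb))
    · simp
    · rintro x y - - ⟨hx, hx'⟩ ⟨hy, hy'⟩
      refine ⟨?_, by rw [map_add]; exact Submodule.add_mem _ hx' hy'⟩
      nth_rewrite 3 [← hx]
      nth_rewrite 3 [← hy]
      simp only [map_add]
      abel
    · rintro r x - ⟨hx, hx'⟩
      refine ⟨?_, by rw [map_smul]; exact Submodule.smul_mem _ _ hx'⟩
      nth_rewrite 3 [← hx]
      simp only [map_smul, smul_add]
  have hHc : H c ∈ Finsupp.supported K K (chainsOfCard (A ∪ B) (n + 1)) := by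
    refine LinearMap.mem_of_mem_supported (f := H) (fun F hF => ?_) hc
    obtain ⟨p, q, hpq, F₁, hF₁, F₂, hF₂, e⟩ := hsplit F hF
    have m1 := Finsupp.single_mem_supported K (1 : K) hF₁
    have m2 := Finsupp.single_mem_supported K (1 : K) hF₂
    rw [e, hH p q _ _ m1 m2, ← hpq, add_right_comm]
    exact chainUnion_mem_chains hAB (hfm p _ m1) m2
  rw [hc0, map_zero, add_zero] at hE
  obtain ⟨h1, h2⟩ := hN _ hE
  refine ⟨H c + G (c - D (H c)), Submodule.add_mem _ hHc h2, ?_⟩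
  have h3 : D (c - D (H c)) = 0 := by
    rw [map_sub, hc0, simplicialBoundary_comp_self, sub_zero]
  rw [h3, map_zero, add_zero] at h1
  rw [map_add, h1, add_sub_cancel]

end Join

/-! ### Order embeddings and successive deletion -/

section Transport

open scoped Classical

variable {K : Type*} [Field K] {P : Type*} [PartialOrder P] {Q : Type*} [PartialOrder Q]

/-- On a chain the linear extension agrees with the given order. The sign is therefore independent
of the extension and survives order embeddings. -/
theorem vertexSign_of_isChain {F : Finset P} (hF : IsChain (· ≤ ·) (F : Set P)) {x : P}
    (hx : x ∈ F) : vertexSign K x F = (-1) ^ (F.filter (· < x)).card := by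
  unfold vertexSign
  congr 2
  refine Finset.filter_congr fun y hy => ⟨fun h => ?_, fun h => ?_⟩
  · rcases hF.total (Finset.mem_coe.2 hy) (Finset.mem_coe.2 hx) with h' | h'
    · exact lt_of_le_of_ne h' (by rintro rfl; exact lt_irrefl _ h)
    · exact absurd (toLinearExtension.monotone h') (not_le.2 h)
  · exact lt_of_le_of_ne (toLinearExtension.monotone h.le) (toLinearExtension_ne h.ne)

theorem image_chainsOfCard (f : P ↪o Q) (S : Set P) (n : ℕ) :
    Finset.image f '' chainsOfCard S n = chainsOfCard (f '' S) n := by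
  ext G
  constructor
  · rintro ⟨F, hF, rfl⟩
    refine ⟨by rw [Finset.card_image_of_injective _ f.injective, hF.1], ?_, ?_⟩
    · rw [Finset.coe_image]; exact Set.image_mono hF.2.1
    · rw [Finset.coe_image]
      rintro _ ⟨x, hx, rfl⟩ _ ⟨y, hy, rfl⟩ _
      exact (hF.2.2.total hx hy).imp f.monotone.imp f.monotone.imp
  · rintro ⟨h1, h2, h3⟩
    obtain ⟨F, hF, rfl⟩ := Finset.subset_set_image_iff.1 h2
    refine ⟨F, ⟨by rw [← h1, Finset.card_image_of_injective _ f.injective], hF, ?_⟩, rfl⟩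
    intro x hx y hy _
    rw [Finset.coe_image] at h3
    exact (h3.total ⟨x, hx, rfl⟩ ⟨y, hy, rfl⟩).imp f.le_iff_le.1 f.le_iff_le.1

theorem simplicialBoundary_mapDomain (f : P ↪o Q) {S : Set P} {n : ℕ} {c : Finset P →₀ K}
    (hc : c ∈ Finsupp.supported K K (chainsOfCard S n)) :
    simplicialBoundary K Q (Finsupp.mapDomain (Finset.image f) c) =
      Finsupp.mapDomain (Finset.image f) (simplicialBoundary K P c) := by
  refine LinearMap.eq_of_mem_supported
    (f := simplicialBoundary K Q ∘ₗ Finsupp.lmapDomain K K (Finset.image f))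
    (g := Finsupp.lmapDomain K K (Finset.image f) ∘ₗ simplicialBoundary K P) (fun F hF => ?_) hc
  have hF' : Finset.image f F ∈ chainsOfCard (f '' S) n := by
    rw [← image_chainsOfCard]; exact ⟨F, hF, rfl⟩
  simp only [LinearMap.comp_apply, Finsupp.lmapDomain_apply, Finsupp.mapDomain_single]
  rw [simplicialBoundary_single, simplicialBoundary_single,
    Finset.sum_image f.injective.injOn, Finsupp.mapDomain_finsetSum]
  refine Finset.sum_congr rfl fun x hx => ?_
  rw [Finsupp.mapDomain_single, Finset.image_erase f.injective, vertexSign_of_isChain hF.2.2 hx,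
    vertexSign_of_isChain hF'.2.2 (Finset.mem_image_of_mem f hx), Finset.filter_image,
    Finset.card_image_of_injective _ f.injective]
  simp only [f.lt_iff_lt]

/-- Vanishing of homology is transported along order embeddings. -/
theorem AcyclicBelow.image {S : Set P} {k : ℕ} (hS : AcyclicBelow K S k) (f : P ↪o Q) :
    AcyclicBelow K (f '' S) k := by
  rw [acyclicBelow_iff] at *
  intro n hn c hc hc0
  rw [← image_chainsOfCard, ← Finsupp.lmapDomain_supported] at hc
  obtain ⟨c, hc, rfl⟩ := hc
  rw [Finsupp.lmapDomain_apply, simplicialBoundary_mapDomain f hc] at hc0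
  have hinj := Finsupp.mapDomain_injective (M := K) (Finset.image_injective f.injective)
  obtain ⟨w, hw, rfl⟩ := hS n hn c hc (hinj (by rw [hc0, Finsupp.mapDomain_zero]))
  refine ⟨Finsupp.mapDomain (Finset.image f) w, ?_, simplicialBoundary_mapDomain f hw⟩
  rw [← image_chainsOfCard, ← Finsupp.lmapDomain_supported]
  exact ⟨w, hw, rfl⟩

/-- Passing from `Q` to `Q ∩ T` by removing the elements outside `T` in increasing order. -/
theorem AcyclicBelow.inter_of_links {Q T : Set P} {k : ℕ} (hQ : Q.Finite)
    (h : AcyclicBelow K Q k)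
    (hl : ∀ y ∈ Q \ T, ∃ p q, k ≤ p + q ∧ AcyclicBelow K (Q ∩ T ∩ Set.Iio y) p ∧
      AcyclicBelow K (Q ∩ Set.Ioi y) q) : AcyclicBelow K (Q ∩ T) k := by
  induction hm : (Q \ T).ncard using Nat.strong_induction_on generalizing Q with
  | _ m ih =>
  have hfin : (Q \ T).Finite := hQ.sdiff
  rcases (Q \ T).eq_empty_or_nonempty with he | hne
  · rwa [Set.inter_eq_left.2 (Set.sdiff_eq_empty.1 he)]
  -- For minimal y everything below y in Q already lies in T, so the link of y in Q is the join
  -- appearing in `hl`.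
  obtain ⟨y, hy, hymin⟩ := hfin.exists_minimal hne
  have hmin : ∀ z ∈ Q, z < y → z ∈ T := fun z hz hzy => by
    by_contra hzT
    exact absurd (hymin ⟨hz, hzT⟩ hzy.le) (not_le_of_gt hzy)
  have e1 : (Q \ {y}) ∩ T = Q ∩ T := by
    ext z
    simp only [Set.mem_inter_iff, Set.mem_sdiff, Set.mem_singleton_iff]
    exact ⟨fun h => ⟨h.1.1, h.2⟩, fun h => ⟨⟨h.1, fun e => hy.2 (e ▸ h.2)⟩, h.2⟩⟩
  rw [← e1]
  refine ih _ ?_ hQ.sdiff ?_ ?_ rfl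
  · rw [← hm]
    refine Set.ncard_lt_ncard ⟨Set.sdiff_subset_sdiff_left Set.sdiff_subset, fun hsub => ?_⟩ hfin
    exact (hsub hy).1.2 rfl
  · refine h.diff_singleton hy.1 ?_
    obtain ⟨p, q, hk, hp, hq⟩ := hl y hy
    have e2 : {z ∈ Q | z < y ∨ y < z} = (Q ∩ T ∩ Set.Iio y) ∪ (Q ∩ Set.Ioi y) := by
      ext z
      simp only [Set.mem_ofPred_eq, Set.mem_union, Set.mem_inter_iff, Set.mem_Iio, Set.mem_Ioi]
      constructor
      · rintro ⟨hz, h | h⟩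
        · exact Or.inl ⟨⟨hz, hmin z hz h⟩, h⟩
        · exact Or.inr ⟨hz, h⟩
      · rintro (⟨⟨hz, -⟩, h⟩ | ⟨hz, h⟩)
        · exact ⟨hz, Or.inl h⟩
        · exact ⟨hz, Or.inr h⟩
    rw [e2]
    exact (hp.union hq fun a ha b hb => lt_trans ha.2 hb.2).mono hk
  · intro z hz
    obtain ⟨p, q, hk, hp, hq⟩ := hl z ⟨hz.1.1, hz.2⟩
    refine ⟨p, q, hk, by rwa [e1], ?_⟩
    -- By minimality y is not above another element outside T, so deleting y leaves the upper parts
    -- of the later links intact.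
    have e3 : (Q \ {y}) ∩ Set.Ioi z = Q ∩ Set.Ioi z := by
      ext u
      simp only [Set.mem_inter_iff, Set.mem_sdiff, Set.mem_singleton_iff, Set.mem_Ioi]
      refine ⟨fun h => ⟨h.1.1, h.2⟩, fun h => ⟨⟨h.1, ?_⟩, h.2⟩⟩
      rintro rfl
      exact hz.2 (hmin z hz.1.1 h.2)
    rwa [e3]

end Transport

/-! ### Words, the bar differential and the shuffle product -/

section BarComplex

variable {K : Type*} [Field K] {M : Type*} [AddCommMonoid M]

/-- Prepending a letter to words. -/
noncomputable def wordCons (K : Type*) [Field K] {M : Type*} (z : M) :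
    (List M →₀ K) →ₗ[K] (List M →₀ K) :=
  Finsupp.lmapDomain K K (z :: ·)

/-- Adding a letter to the first letter of words; the empty word is sent to zero. -/
noncomputable def wordMerge (K : Type*) [Field K] {M : Type*} [AddCommMonoid M] (z : M) :
    (List M →₀ K) →ₗ[K] (List M →₀ K) :=
  Finsupp.linearCombination K fun l => match l with
    | [] => 0
    | b :: t => Finsupp.single ((z + b) :: t) 1

/-- The bar differential of a word. -/
noncomputable def barWord (K : Type*) [Field K] {M : Type*} [AddCommMonoid M] :
    List M → (List M →₀ K)
  | [] => 0
  | z :: l => wordMerge K z (Finsupp.single l 1) - wordCons K z (barWord K l)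

/-- The bar differential: the alternating sum of the words obtained by adding two neighbouring
letters. -/
noncomputable def barDifferential (K : Type*) [Field K] (M : Type*) [AddCommMonoid M] :
    (List M →₀ K) →ₗ[K] (List M →₀ K) :=
  Finsupp.linearCombination K (barWord K)

/-- Multiplication of a word by the parity of its length. -/
noncomputable def wordParity (K : Type*) [Field K] (M : Type*) :
    (List M →₀ K) →ₗ[K] (List M →₀ K) :=
  Finsupp.linearCombination K fun l => Finsupp.single l ((-1 : K) ^ l.length)

/-- The signed shuffle product of two words. -/
noncomputable def shuffleWord (K : Type*) [Field K] {M : Type*} :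
    List M → List M → (List M →₀ K)
  | [], u => Finsupp.single u 1
  | a :: v, [] => Finsupp.single (a :: v) 1
  | a :: v, b :: u => wordCons K a (shuffleWord K v (b :: u)) -
      (-1 : K) ^ v.length • wordCons K b (shuffleWord K (a :: v) u)

/-- The signed shuffle product. -/
noncomputable def shuffleProduct (K : Type*) [Field K] (M : Type*) :
    (List M →₀ K) →ₗ[K] (List M →₀ K) →ₗ[K] (List M →₀ K) :=
  Finsupp.linearCombination K fun v => Finsupp.linearCombination K (shuffleWord K v)

/-- The signed sum of the shuffles of the reverse of the initial subword of letters of degree zero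
with the rest of the word that start with the first letter of nonzero degree. The letters of degree
zero that have been read already are collected in the first argument. -/
noncomputable def retractWord (K : Type*) [Field K] {M : Type*} [AddCommMonoid M] (d : M →+ ℕ) :
    List M → List M → (List M →₀ K)
  | _, [] => 0
  | v, z :: l => if d z = 0 then (-1 : K) ^ v.length • retractWord K d (z :: v) l
      else wordCons K z (shuffleWord K v l)

/-- The bilinear extension of `retractWord`. -/
noncomputable def retractProduct (K : Type*) [Field K] {M : Type*} [AddCommMonoid M] (d : M →+ ℕ) :
    (List M →₀ K) →ₗ[K] (List M →₀ K) →ₗ[K] (List M →₀ K) :=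
  Finsupp.linearCombination K fun v => Finsupp.linearCombination K (retractWord K d v)

theorem wordCons_single {M : Type*} (z : M) (l : List M) :
    wordCons K z (Finsupp.single l 1) = Finsupp.single (z :: l) 1 := by
  simp [wordCons]

theorem wordMerge_nil (z : M) : wordMerge K z (Finsupp.single [] 1) = 0 := by
  simp [wordMerge, Finsupp.linearCombination_single]

theorem wordMerge_cons (z b : M) (l : List M) :
    wordMerge K z (Finsupp.single (b :: l) 1) = Finsupp.single ((z + b) :: l) 1 := by
  simp [wordMerge, Finsupp.linearCombination_single]

theorem barDifferential_single (l : List M) :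
    barDifferential K M (Finsupp.single l 1) = barWord K l := by
  simp [barDifferential, Finsupp.linearCombination_single]

theorem wordParity_single {M : Type*} (l : List M) :
    wordParity K M (Finsupp.single l 1) = (-1 : K) ^ l.length • Finsupp.single l 1 := by
  simp [wordParity, Finsupp.linearCombination_single]

theorem shuffleProduct_single {M : Type*} (v u : List M) :
    shuffleProduct K M (Finsupp.single v 1) (Finsupp.single u 1) = shuffleWord K v u := by
  simp [shuffleProduct, Finsupp.linearCombination_single]

theorem retractProduct_single (d : M →+ ℕ) (v u : List M) :
    retractProduct K d (Finsupp.single v 1) (Finsupp.single u 1) = retractWord K d v u := by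
  simp [retractProduct, Finsupp.linearCombination_single]

theorem shuffleWord_nil_right {M : Type*} (v : List M) : shuffleWord K v [] = Finsupp.single v 1 := by
  cases v <;> simp [shuffleWord]

/-- Linear maps that agree on words are equal. -/
theorem LinearMap.ext_words {α N : Type*} [AddCommGroup N] [Module K N]
    {f g : (α →₀ K) →ₗ[K] N} (h : ∀ a, f (Finsupp.single a 1) = g (Finsupp.single a 1))
    (X : α →₀ K) : f X = g X :=
  LinearMap.eq_of_mem_supported (s := Set.univ) (fun a _ => h a) (by simp)

theorem wordMerge_wordCons (a b : M) (X : List M →₀ K) :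
    wordMerge K a (wordCons K b X) = wordCons K (a + b) X := by
  refine LinearMap.ext_words (f := wordMerge K a ∘ₗ wordCons K b) (fun l => ?_) X
  rw [LinearMap.comp_apply, wordCons_single, wordMerge_cons, wordCons_single]

theorem barDifferential_wordCons (a : M) (X : List M →₀ K) :
    barDifferential K M (wordCons K a X) =
      wordMerge K a X - wordCons K a (barDifferential K M X) := by
  refine LinearMap.ext_words (f := barDifferential K M ∘ₗ wordCons K a)
    (g := wordMerge K a - wordCons K a ∘ₗ barDifferential K M) (fun l => ?_) X
  simp only [LinearMap.comp_apply, LinearMap.sub_apply]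
  rw [wordCons_single, barDifferential_single, barDifferential_single, barWord]

theorem wordParity_wordCons {M : Type*} (a : M) (X : List M →₀ K) :
    wordParity K M (wordCons K a X) = -wordCons K a (wordParity K M X) := by
  refine LinearMap.ext_words (f := wordParity K M ∘ₗ wordCons K a)
    (g := -(wordCons K a ∘ₗ wordParity K M)) (fun l => ?_) X
  simp only [LinearMap.comp_apply, LinearMap.neg_apply]
  rw [wordCons_single, wordParity_single, wordParity_single, map_smul, wordCons_single,
    List.length_cons, pow_succ]
  simp

theorem wordParity_wordMerge (a : M) (X : List M →₀ K) :
    wordParity K M (wordMerge K a X) = wordMerge K a (wordParity K M X) := by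
  refine LinearMap.ext_words (f := wordParity K M ∘ₗ wordMerge K a)
    (g := wordMerge K a ∘ₗ wordParity K M) (fun l => ?_) X
  simp only [LinearMap.comp_apply]
  cases l with
  | nil => rw [wordParity_single, map_smul, wordMerge_nil]; simp
  | cons b l =>
    rw [wordParity_single, map_smul, wordMerge_cons, wordParity_single]; simp

theorem wordParity_wordParity {M : Type*} (X : List M →₀ K) :
    wordParity K M (wordParity K M X) = X := by
  refine LinearMap.ext_words (f := wordParity K M ∘ₗ wordParity K M) (g := LinearMap.id)
    (fun l => ?_) X
  simp only [LinearMap.comp_apply, LinearMap.id_apply]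
  rw [wordParity_single, map_smul, wordParity_single, smul_smul, ← pow_add, ← two_mul, pow_mul]
  simp

theorem wordParity_barDifferential (X : List M →₀ K) :
    wordParity K M (barDifferential K M X) = -barDifferential K M (wordParity K M X) := by
  refine LinearMap.ext_words (f := wordParity K M ∘ₗ barDifferential K M)
    (g := -(barDifferential K M ∘ₗ wordParity K M)) (fun l => ?_) X
  simp only [LinearMap.comp_apply, LinearMap.neg_apply]
  induction l with
  | nil => simp [wordParity_single, barDifferential_single, barWord]
  | cons z l ih =>
    rw [← wordCons_single, wordParity_wordCons, barDifferential_wordCons, map_sub, map_neg,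
      barDifferential_wordCons, wordParity_wordMerge, wordParity_wordCons, ih, map_neg]
    abel

theorem shuffleProduct_nil_left {M : Type*} (X : List M →₀ K) :
    shuffleProduct K M (Finsupp.single [] 1) X = X := by
  refine LinearMap.ext_words (f := shuffleProduct K M (Finsupp.single [] 1)) (g := LinearMap.id)
    (fun l => ?_) X
  rw [shuffleProduct_single, shuffleWord]; rfl

theorem shuffleProduct_nil_right {M : Type*} (X : List M →₀ K) :
    shuffleProduct K M X (Finsupp.single [] 1) = X := by
  refine LinearMap.ext_words (f := (shuffleProduct K M).flip (Finsupp.single [] 1))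
    (g := LinearMap.id) (fun l => ?_) X
  rw [LinearMap.flip_apply, shuffleProduct_single, shuffleWord_nil_right]; rfl

/-- Bilinear maps that agree on words are equal. -/
theorem LinearMap.ext_words₂ {α β N : Type*} [AddCommGroup N] [Module K N]
    {f g : (α →₀ K) →ₗ[K] (β →₀ K) →ₗ[K] N}
    (h : ∀ a b, f (Finsupp.single a 1) (Finsupp.single b 1) =
      g (Finsupp.single a 1) (Finsupp.single b 1)) (X : α →₀ K) (Y : β →₀ K) :
    f X Y = g X Y :=
  LinearMap.eq_of_mem_supported₂ (s := Set.univ) (t := Set.univ) (fun a _ b _ => h a b) (by simp)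
    (by simp)

theorem shuffleProduct_wordCons {M : Type*} (a b : M) (X Y : List M →₀ K) :
    shuffleProduct K M (wordCons K a X) (wordCons K b Y) =
      wordCons K a (shuffleProduct K M X (wordCons K b Y)) -
        wordCons K b (shuffleProduct K M (wordCons K a (wordParity K M X)) Y) := by
  rw [eq_sub_iff_add_eq]
  have := LinearMap.ext_words₂ (K := K) (f := (shuffleProduct K M).compl₁₂ (wordCons K a)
      (wordCons K b) + (shuffleProduct K M ∘ₗ wordCons K a ∘ₗ wordParity K M).compr₂ (wordCons K b))
    (g := ((shuffleProduct K M).compl₂ (wordCons K b)).compr₂ (wordCons K a)) (fun v u => ?_) X Y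
  · simpa only [LinearMap.compl₁₂_apply, LinearMap.add_apply, LinearMap.compr₂_apply,
      LinearMap.compl₂_apply, LinearMap.comp_apply] using this
  · simp only [LinearMap.compl₁₂_apply, LinearMap.add_apply, LinearMap.compr₂_apply,
      LinearMap.compl₂_apply, LinearMap.comp_apply]
    rw [wordParity_single, map_smul, map_smul, LinearMap.smul_apply, map_smul]
    simp only [wordCons_single, shuffleProduct_single]
    rw [shuffleWord, sub_add_cancel]

theorem retractProduct_wordCons_of_eq {d : M →+ ℕ} {s : M} (hs : d s = 0) (X Y : List M →₀ K) :
    retractProduct K d X (wordCons K s Y) =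
      retractProduct K d (wordCons K s (wordParity K M X)) Y := by
  have := LinearMap.ext_words₂ (K := K) (f := (retractProduct K d).compl₂ (wordCons K s))
    (g := retractProduct K d ∘ₗ wordCons K s ∘ₗ wordParity K M) (fun v u => ?_) X Y
  · simpa only [LinearMap.compl₂_apply, LinearMap.comp_apply] using this
  · simp only [LinearMap.compl₂_apply, LinearMap.comp_apply]
    rw [wordParity_single, map_smul, map_smul, LinearMap.smul_apply]
    simp only [wordCons_single, retractProduct_single]
    rw [retractWord, if_pos hs]

theorem retractProduct_wordCons_of_ne {d : M →+ ℕ} {z : M} (hz : d z ≠ 0) (X Y : List M →₀ K) :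
    retractProduct K d X (wordCons K z Y) = wordCons K z (shuffleProduct K M X Y) := by
  have := LinearMap.ext_words₂ (K := K) (f := (retractProduct K d).compl₂ (wordCons K z))
    (g := (shuffleProduct K M).compr₂ (wordCons K z)) (fun v u => ?_) X Y
  · simpa only [LinearMap.compl₂_apply, LinearMap.compr₂_apply] using this
  · simp only [LinearMap.compl₂_apply, LinearMap.compr₂_apply]
    simp only [wordCons_single, retractProduct_single, shuffleProduct_single]
    rw [retractWord, if_neg hz]

/-- These are the terms of the derivation rule for the words a :: v and b :: u in which a or b is
merged with a neighbour; induction handles the rest. The words starting with a + b cancel those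
starting with b + a, which is where commutativity enters. -/
theorem shuffle_merge_identity (a b : M) (v u : List M) :
    wordMerge K a (shuffleProduct K M (Finsupp.single v 1) (Finsupp.single (b :: u) 1)) -
      (-1 : K) ^ v.length • wordCons K a
        (shuffleProduct K M (Finsupp.single v 1) (wordMerge K b (Finsupp.single u 1))) -
      (-1 : K) ^ v.length • wordMerge K b
        (shuffleProduct K M (Finsupp.single (a :: v) 1) (Finsupp.single u 1)) +
      (-1 : K) ^ v.length • wordCons K b
        (shuffleProduct K M (wordMerge K a (Finsupp.single v 1)) (Finsupp.single u 1)) -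
      shuffleProduct K M (wordMerge K a (Finsupp.single v 1)) (Finsupp.single (b :: u) 1) +
      (-1 : K) ^ v.length • shuffleProduct K M (Finsupp.single (a :: v) 1)
        (wordMerge K b (Finsupp.single u 1)) = 0 := by
  cases v with
  | nil =>
    cases u with
    | nil =>
      simp [wordMerge_nil, wordMerge_cons, shuffleProduct_nil_left, shuffleProduct_nil_right,
        add_comm b a]
    | cons c u =>
      simp only [wordMerge_nil, wordMerge_cons, shuffleProduct_nil_left, List.length_nil, pow_zero,
        one_smul, map_zero, LinearMap.zero_apply]
      simp only [← wordCons_single, shuffleProduct_wordCons, wordMerge_wordCons, map_sub,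
        wordParity_single, List.length_nil, pow_zero, one_smul,
        shuffleProduct_nil_left, add_comm b a]
      abel
  | cons a' v =>
    cases u with
    | nil =>
      simp only [wordMerge_nil, wordMerge_cons, shuffleProduct_nil_right, map_zero]
      simp only [← wordCons_single, shuffleProduct_wordCons, wordMerge_wordCons, map_sub, map_smul,
        LinearMap.smul_apply, wordParity_single,
        shuffleProduct_nil_right, add_comm b a, List.length_cons]
      rcases neg_one_pow_eq_or K v.length with h | h <;> simp only [pow_succ, h] <;> simp
    | cons c u =>
      simp only [wordMerge_cons]
      simp only [← wordCons_single, shuffleProduct_wordCons, wordMerge_wordCons, map_sub, map_smul,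
        map_neg, LinearMap.neg_apply, LinearMap.smul_apply, wordParity_single, wordParity_wordCons,
        add_comm b a, List.length_cons]
      rcases neg_one_pow_eq_or K v.length with h | h <;> simp only [pow_succ, h] <;> simp <;> abel

/-- The bar differential is a derivation of the shuffle product. -/
theorem barDifferential_shuffleProduct (v u : List M) :
    barDifferential K M (shuffleProduct K M (Finsupp.single v 1) (Finsupp.single u 1)) =
      shuffleProduct K M (barDifferential K M (Finsupp.single v 1)) (Finsupp.single u 1) +
        (-1 : K) ^ v.length • shuffleProduct K M (Finsupp.single v 1)
          (barDifferential K M (Finsupp.single u 1)) := by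
  induction v generalizing u with
  | nil =>
    simp [shuffleProduct_nil_left, barDifferential_single, barWord]
  | cons a v ihv =>
    induction u with
    | nil =>
      simp [shuffleProduct_nil_right, barDifferential_single, barWord]
    | cons b u ihu =>
      have key := shuffle_merge_identity (K := K) a b v u
      have e1 := ihv (b :: u)
      have e2 := ihu
      have p1 : wordParity K M (barDifferential K M (Finsupp.single v 1)) =
          -((-1 : K) ^ v.length • barDifferential K M (Finsupp.single v 1)) := by
        rw [wordParity_barDifferential, wordParity_single, map_smul]
      simp only [← wordCons_single, shuffleProduct_wordCons, map_sub, barDifferential_wordCons,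
        map_smul, map_neg, LinearMap.neg_apply, LinearMap.smul_apply, LinearMap.sub_apply,
        wordParity_single, smul_sub, p1, List.length_cons] at e1 e2 key ⊢
      rw [e1, e2]
      rw [← sub_eq_zero]
      refine Eq.trans ?_ key
      simp only [map_sub, map_add, map_smul]
      rcases neg_one_pow_eq_or K v.length with h | h <;> simp only [pow_succ, h] <;>
        simp <;> abel

end BarComplex

/-! ### The retraction onto words whose first letter has nonzero degree -/

section Retraction

variable {K : Type*} [Field K] {M : Type*} [AddCommMonoid M]

theorem retractProduct_nil_right (d : M →+ ℕ) (X : List M →₀ K) :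
    retractProduct K d X (Finsupp.single [] 1) = 0 := by
  refine LinearMap.ext_words (f := (retractProduct K d).flip (Finsupp.single [] 1)) (g := 0)
    (fun l => ?_) X
  rw [LinearMap.flip_apply, retractProduct_single, retractWord]; rfl

/-- The term that corrects the failure of `retractProduct` to be a derivation. -/
noncomputable def retractDefect (K : Type*) [Field K] {M : Type*} [AddCommMonoid M] (d : M →+ ℕ) :
    List M → List M → (List M →₀ K)
  | [], _ => 0
  | c :: v, l => retractProduct K d (Finsupp.single v 1) (wordMerge K c (Finsupp.single l 1))

/-- The pair (v, l) stands for the word formed by the reverse of v followed by l. Its bar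
differential has terms inside v, terms inside l, and one term at the junction, where the head of v
is merged with the head of l; that term is the defect. It is absent for empty v. -/
theorem barDifferential_retractProduct (d : M →+ ℕ) {v : List M} (hv : ∀ c ∈ v, d c = 0)
    (l : List M) :
    barDifferential K M (retractProduct K d (Finsupp.single v 1) (Finsupp.single l 1)) =
      -retractProduct K d (barDifferential K M (Finsupp.single v 1)) (Finsupp.single l 1) +
        (-1 : K) ^ v.length • retractProduct K d (Finsupp.single v 1)
          (barDifferential K M (Finsupp.single l 1)) + retractDefect K d v l := by
  induction l generalizing v with
  | nil =>
    cases v <;>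
      simp [retractProduct_nil_right, barDifferential_single, barWord, retractDefect, wordMerge_nil]
  | cons z u ih =>
    have p1 : wordParity K M (barDifferential K M (Finsupp.single v 1)) =
        -((-1 : K) ^ v.length • barDifferential K M (Finsupp.single v 1)) := by
      rw [wordParity_barDifferential, wordParity_single, map_smul]
    -- A letter of degree zero moves over to v, and the induction hypothesis applies. A letter of
    -- nonzero degree ends the reading, and the derivation rule for shuffles takes over.
    by_cases hz : d z = 0
    · have e := ih (v := z :: v) (by simpa [hz] using hv)
      have hdef : retractDefect K d v (z :: u) = -((-1 : K) ^ v.length •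
          retractProduct K d (wordMerge K z (Finsupp.single v 1)) (Finsupp.single u 1)) := by
        cases v with
        | nil => simp [retractDefect, wordMerge_nil]
        | cons c v =>
          have hc : d (c + z) = 0 := by rw [map_add, hz, hv c (by simp)]
          rw [retractDefect, wordMerge_cons, wordMerge_cons, ← wordCons_single,
            retractProduct_wordCons_of_eq hc, wordParity_single, map_smul, map_smul,
            LinearMap.smul_apply, wordCons_single, add_comm z c, List.length_cons, pow_succ]
          simp
      simp only [retractDefect] at e
      simp only [← wordCons_single, retractProduct_wordCons_of_eq hz, map_sub,
        barDifferential_wordCons, map_smul, map_neg, LinearMap.neg_apply, LinearMap.smul_apply,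
        LinearMap.sub_apply, wordParity_single, p1, List.length_cons] at e ⊢
      rw [hdef, e]
      rcases neg_one_pow_eq_or K v.length with h | h <;> simp only [pow_succ, h] <;>
        simp <;> abel
    · have e := barDifferential_shuffleProduct (K := K) v u
      have hdef : retractDefect K d v (z :: u) =
          wordMerge K z (shuffleProduct K M (Finsupp.single v 1) (Finsupp.single u 1)) -
          (-1 : K) ^ v.length • retractProduct K d (Finsupp.single v 1)
            (wordMerge K z (Finsupp.single u 1)) := by
        have hzb : ∀ b, d (z + b) ≠ 0 := fun b => by rw [map_add]; omega
        cases v with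
        | nil =>
          cases u with
          | nil => simp [retractDefect, wordMerge_nil, shuffleProduct_nil_left]
          | cons b u =>
            rw [retractDefect, shuffleProduct_nil_left, wordMerge_cons, ← wordCons_single,
              retractProduct_wordCons_of_ne (hzb b), shuffleProduct_nil_left]
            simp
        | cons c v =>
          rw [retractDefect, wordMerge_cons, add_comm c z, ← wordCons_single,
            retractProduct_wordCons_of_ne (hzb c)]
          cases u with
          | nil =>
            simp only [shuffleProduct_nil_right, wordMerge_cons, wordMerge_nil, wordCons_single]
            simp
          | cons b u =>
            simp only [wordMerge_cons]
            simp only [← wordCons_single, shuffleProduct_wordCons, map_sub, wordMerge_wordCons,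
              retractProduct_wordCons_of_ne (hzb b), wordParity_single, map_smul,
              LinearMap.smul_apply, List.length_cons, pow_succ]
            simp
      simp only [← wordCons_single, retractProduct_wordCons_of_ne hz, map_sub,
        barDifferential_wordCons] 
      rw [hdef, e]
      simp only [map_add, map_smul]
      rcases neg_one_pow_eq_or K v.length with h | h <;> simp only [h] <;>
        simp <;> abel

/-- `retractProduct` with empty first argument is a chain map. -/
theorem barDifferential_retractProduct_nil (d : M →+ ℕ) (X : List M →₀ K) :
    barDifferential K M (retractProduct K d (Finsupp.single [] 1) X) =
      retractProduct K d (Finsupp.single [] 1) (barDifferential K M X) := by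
  refine LinearMap.ext_words
    (f := barDifferential K M ∘ₗ retractProduct K d (Finsupp.single [] 1))
    (g := retractProduct K d (Finsupp.single [] 1) ∘ₗ barDifferential K M) (fun l => ?_) X
  rw [LinearMap.comp_apply, LinearMap.comp_apply, barDifferential_retractProduct d (by simp)]
  rw [barDifferential_single []]
  simp [barWord, retractDefect]

theorem wordCons_mem_supported {M : Type*} {s t : Set (List M)} {z : M} (h : ∀ l ∈ s, z :: l ∈ t)
    {X : List M →₀ K} (hX : X ∈ Finsupp.supported K K s) :
    wordCons K z X ∈ Finsupp.supported K K t := by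
  refine LinearMap.mem_of_mem_supported (fun l hl => ?_) hX
  rw [wordCons_single]
  exact Finsupp.single_mem_supported K _ (h l hl)

theorem shuffleWord_mem_supported {M : Type*} (v u : List M) :
    shuffleWord K v u ∈ Finsupp.supported K K {w : List M | w.Perm (v ++ u)} := by
  induction v generalizing u with
  | nil =>
    rw [shuffleWord]
    exact Finsupp.single_mem_supported K _ (List.Perm.refl u)
  | cons a v ihv =>
    induction u with
    | nil =>
      rw [shuffleWord]
      refine Finsupp.single_mem_supported K _ ?_
      rw [List.append_nil]
      exact List.Perm.refl _
    | cons b u ihu =>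
      rw [shuffleWord]
      have h1 := wordCons_mem_supported (t := {w : List M | w.Perm (a :: v ++ b :: u)})
        (fun l hl => List.Perm.cons a hl) (ihv (b :: u))
      have h2 := wordCons_mem_supported (t := {w : List M | w.Perm (a :: v ++ b :: u)})
        (fun l hl => (List.Perm.cons b hl).trans List.perm_middle.symm) ihu
      exact Submodule.sub_mem _ h1 (Submodule.smul_mem _ _ h2)

theorem retractWord_mem_supported (d : M →+ ℕ) (v l : List M) :
    retractWord K d v l ∈ Finsupp.supported K K
      {w : List M | w.Perm (v ++ l) ∧ ∃ z t, w = z :: t ∧ d z ≠ 0} := by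
  induction l generalizing v with
  | nil => exact Submodule.zero_mem _
  | cons z l ih =>
    rw [retractWord]
    split_ifs with hz
    · refine Submodule.smul_mem _ _ (Finsupp.supported_mono ?_ (ih (z :: v)))
      exact fun w hw => ⟨hw.1.trans List.perm_middle.symm, hw.2⟩
    · exact wordCons_mem_supported (t := {w : List M | w.Perm (v ++ z :: l) ∧
          ∃ z t, w = z :: t ∧ d z ≠ 0})
        (fun w hw => ⟨(List.Perm.cons z hw).trans List.perm_middle.symm, z, w, rfl, hz⟩)
        (shuffleWord_mem_supported v l)

theorem retractWord_nil_of_ne {d : M →+ ℕ} {z : M} (hz : d z ≠ 0) (l : List M) :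
    retractWord K d [] (z :: l) = Finsupp.single (z :: l) 1 := by
  rw [retractWord, if_neg hz, shuffleWord, wordCons_single]

end Retraction

/-! ### Chains in an interval as words, and the subset of lower degree -/

section SuffixSums

open scoped Classical

variable {K : Type*} [Field K] {M : Type*} [AddCommMonoid M]

/-- The sums of the proper nonempty suffixes of a word. -/
noncomputable def suffixSums {M : Type*} [AddCommMonoid M] : List M → Finset M
  | [] => ∅
  | [_] => ∅
  | _ :: b :: l => insert (b :: l).sum (suffixSums (b :: l))

/-- The words with `n` nonzero letters and sum `x`. -/
def wordsOfSum {M : Type*} [AddCommMonoid M] (x : M) (n : ℕ) : Set (List M) :=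
  {l | (∀ z ∈ l, z ≠ 0) ∧ l.sum = x ∧ l.length = n}

theorem suffixSums_cons {z : M} {l : List M} (hl : l ≠ []) :
    suffixSums (z :: l) = insert l.sum (suffixSums l) := by
  cases l with
  | nil => exact absurd rfl hl
  | cons b l => rfl

theorem suffixSums_cons_congr (z z' : M) (l : List M) :
    suffixSums (z :: l) = suffixSums (z' :: l) := by
  cases l <;> rfl

variable [PartialOrder M] [CanonicallyOrderedAdd M]

theorem barWord_mem_supported {x : M} {n : ℕ} {l : List M} (hl : l ∈ wordsOfSum x (n + 1)) :
    barWord K l ∈ Finsupp.supported K K (wordsOfSum x n) := by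
  induction l generalizing x n with
  | nil => exact Submodule.zero_mem _
  | cons z l ih =>
    obtain ⟨h1, h2, h3⟩ := hl
    rw [barWord]
    cases l with
    | nil =>
      rw [wordMerge_nil, barWord, map_zero, sub_zero]
      exact Submodule.zero_mem _
    | cons b t =>
      simp only [List.mem_cons, forall_eq_or_imp, List.sum_cons, List.length_cons] at h1 h2 h3
      refine Submodule.sub_mem _ ?_ ?_
      · rw [wordMerge_cons]
        refine Finsupp.single_mem_supported K _ ⟨?_, ?_, ?_⟩
        · simp only [List.mem_cons, forall_eq_or_imp]
          exact ⟨fun h => h1.1 (add_eq_zero.1 h).1, h1.2.2⟩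
        · rw [List.sum_cons, ← h2, add_assoc]
        · rw [List.length_cons]; omega
      · have h4 : (b :: t) ∈ wordsOfSum (b + t.sum) (t.length + 1) :=
          ⟨by simpa using h1.2, by simp, by simp⟩
        refine wordCons_mem_supported (t := wordsOfSum x n) (fun w hw => ⟨?_, ?_, ?_⟩) (ih h4)
        · simp only [List.mem_cons, forall_eq_or_imp]
          exact ⟨h1.1, hw.1⟩
        · rw [List.sum_cons, hw.2.1, h2]
        · rw [List.length_cons, hw.2.2]; omega

theorem IsChain.exists_greatest {P : Type*} [PartialOrder P] {F : Finset P}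
    (hF : IsChain (· ≤ ·) (F : Set P)) (hne : F.Nonempty) : ∃ y ∈ F, ∀ z ∈ F, z ≤ y := by
  obtain ⟨y, hy, hmax⟩ := F.exists_maximal hne
  exact ⟨y, hy, fun z hz => (hF.total hz hy).elim id fun h => hmax hz h⟩

/-- Every chain in an open interval `(0, x)` comes from a word. -/
theorem exists_suffixSums_eq {x : M} (hx : x ≠ 0) {n : ℕ} {F : Finset M}
    (hF : F ∈ chainsOfCard (Set.Ioo 0 x) n) :
    ∃ z l, z :: l ∈ wordsOfSum x (n + 1) ∧ suffixSums (z :: l) = F ∧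
      (z = x ∨ ∃ y ∈ F, z + y = x) := by
  induction n generalizing x F with
  | zero =>
    rw [Finset.card_eq_zero.1 hF.1]
    exact ⟨x, [], ⟨by simpa using hx, by simp, rfl⟩, rfl, Or.inl rfl⟩
  | succ n ih =>
    obtain ⟨y, hy, hmax⟩ := hF.2.2.exists_greatest
      (Finset.card_pos.1 (by rw [hF.1]; exact n.succ_pos))
    have he := erase_mem_chainsOfCard hF hy
    have hy0 := hF.2.1 hy
    obtain ⟨b, t, hw, hs, -⟩ := ih hy0.1.ne' (F := F.erase y) ⟨he.1, fun u hu => ⟨(he.2.1 hu).1,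
      lt_of_le_of_ne (hmax u (Finset.mem_of_mem_erase hu)) (Finset.ne_of_mem_erase hu)⟩, he.2.2⟩
    obtain ⟨z, hz⟩ := exists_add_of_le hy0.2.le
    refine ⟨z, b :: t, ⟨?_, ?_, by rw [List.length_cons, hw.2.2]⟩, ?_, Or.inr ⟨y, hy, ?_⟩⟩
    · simp only [List.mem_cons, forall_eq_or_imp]
      refine ⟨?_, by simpa using hw.1⟩
      rintro rfl
      exact hy0.2.ne (by rw [hz, add_zero])
    · rw [List.sum_cons, hw.2.1, hz, add_comm]
    · rw [suffixSums_cons (List.cons_ne_nil b t), hs, hw.2.1, Finset.insert_erase hy]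
    · rw [hz, add_comm]

variable [IsOrderedCancelAddMonoid M]

theorem lt_add_of_ne_zero_left {z : M} (hz : z ≠ 0) (y : M) : y < z + y :=
  lt_add_of_pos_left y (pos_iff_ne_zero.2 hz)

theorem suffixSums_mem_chainsOfCard {x : M} {n : ℕ} {l : List M}
    (hl : l ∈ wordsOfSum x (n + 1)) : suffixSums l ∈ chainsOfCard (Set.Ioo 0 x) n := by
  induction l generalizing x n with
  | nil => simp [wordsOfSum] at hl
  | cons z l ih =>
    obtain ⟨h1, h2, h3⟩ := hl
    cases l with
    | nil =>
      have : n = 0 := by simpa using h3.symm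
      subst this
      exact ⟨rfl, by simp [suffixSums], by simp [suffixSums]⟩
    | cons b t =>
      simp only [List.mem_cons, forall_eq_or_imp, List.sum_cons, List.length_cons] at h1 h2 h3
      have h4 : (b :: t) ∈ wordsOfSum (b :: t).sum (t.length + 1) :=
        ⟨by simpa using h1.2, rfl, by simp⟩
      obtain ⟨c1, c2, c3⟩ := ih h4
      have hlt : (b :: t).sum < x := by
        rw [← h2, ← List.sum_cons]
        exact lt_add_of_ne_zero_left h1.1 _
      have hpos : 0 < (b :: t).sum := by
        rw [pos_iff_ne_zero, List.sum_cons]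
        exact fun h => h1.2.1 (add_eq_zero.1 h).1
      rw [suffixSums_cons (List.cons_ne_nil b t)]
      refine ⟨?_, ?_, ?_⟩
      · rw [Finset.card_insert_of_notMem (fun h => lt_irrefl _ (c2 h).2), c1]; omega
      · rw [Finset.coe_insert, Set.insert_subset_iff]
        exact ⟨⟨hpos, hlt⟩, fun y hy => ⟨(c2 hy).1, (c2 hy).2.trans hlt⟩⟩
      · rw [Finset.coe_insert]
        exact c3.insert fun y hy _ => Or.inr (c2 hy).2.le

theorem vertexSign_of_lt {P : Type*} [PartialOrder P] {y : P} {F : Finset P} (h : ∀ x ∈ F, x < y) :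
    vertexSign K y F = (-1) ^ F.card := by
  unfold vertexSign
  rw [Finset.filter_true_of_mem]
  exact fun x hx => lt_of_le_of_ne (toLinearExtension.monotone (h x hx).le)
    (toLinearExtension_ne (h x hx).ne)

/-- Taking suffix sums turns the bar differential into the simplicial boundary. -/
theorem simplicialBoundary_suffixSums {x : M} {n : ℕ} {l : List M}
    (hl : l ∈ wordsOfSum x (n + 1)) :
    simplicialBoundary K M (Finsupp.single (suffixSums l) 1) =
      (-1 : K) ^ l.length • Finsupp.mapDomain suffixSums (barWord K l) := by
  induction l generalizing x n with
  | nil => simp [wordsOfSum] at hl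
  | cons z l ih =>
    cases l with
    | nil => simp [suffixSums, simplicialBoundary_single, barWord, wordMerge_nil]
    | cons b t =>
      obtain ⟨h1, h2, h3⟩ := hl
      simp only [List.mem_cons, forall_eq_or_imp] at h1
      set l' := b :: t with hl'
      have h4 : l' ∈ wordsOfSum l'.sum (t.length + 1) :=
        ⟨by simpa [hl'] using h1.2, rfl, by simp [hl']⟩
      have hne : l'.sum ≠ 0 := by
        rw [hl', List.sum_cons]
        exact fun h => h1.2.1 (add_eq_zero.1 h).1
      obtain ⟨c1, c2, c3⟩ := suffixSums_mem_chainsOfCard h4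
      have hnot : l'.sum ∉ suffixSums l' := fun h => lt_irrefl _ (c2 h).2
      -- Prepending a letter to a word amounts to coning its chain with the sum of the word. This
      -- apex lies above the whole chain, so the sign depends only on the length.
      have hcone : simplicialCone K l'.sum (Finsupp.mapDomain suffixSums (barWord K l')) =
          -((-1 : K) ^ t.length • Finsupp.mapDomain suffixSums (wordCons K z (barWord K l'))) := by
        refine LinearMap.eq_of_mem_supported
          (f := simplicialCone K l'.sum ∘ₗ Finsupp.lmapDomain K K suffixSums)
          (g := -((-1 : K) ^ t.length • Finsupp.lmapDomain K K suffixSums ∘ₗ wordCons K z))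
          (fun w hw => ?_) (barWord_mem_supported h4)
        have hw0 : w ≠ [] := by rintro rfl; exact hne hw.2.1.symm
        obtain ⟨m, hm⟩ : ∃ m, t.length = m + 1 :=
          ⟨t.length - 1, by
            have := List.length_pos_iff.2 hw0
            have := hw.2.2
            omega⟩
        have hwc := suffixSums_mem_chainsOfCard (x := l'.sum) (n := m) (l := w)
          ⟨hw.1, hw.2.1, by rw [hw.2.2, hm]⟩
        simp only [LinearMap.comp_apply, LinearMap.neg_apply, LinearMap.smul_apply,
          Finsupp.lmapDomain_apply, wordCons_single, Finsupp.mapDomain_single]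
        rw [simplicialCone_single (fun h => lt_irrefl _ (hwc.2.1 h).2), suffixSums_cons hw0,
          hw.2.1, vertexSign_of_lt (fun y hy => (hwc.2.1 hy).2), hwc.1, hm, pow_succ]
        simp
      have e : Finsupp.single (suffixSums (z :: l')) (1 : K) =
          (-1 : K) ^ t.length • simplicialCone K l'.sum (Finsupp.single (suffixSums l') 1) := by
        rw [simplicialCone_single hnot, vertexSign_of_lt (fun y hy => (c2 hy).2), c1,
          suffixSums_cons (List.cons_ne_nil b t), Finsupp.smul_single, smul_eq_mul, one_mul,
          ← pow_add, ← two_mul, pow_mul, neg_one_sq, one_pow]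
      have hm : Finsupp.mapDomain suffixSums (wordMerge K z (Finsupp.single l' 1)) =
          Finsupp.single (suffixSums l') (1 : K) := by
        rw [hl', wordMerge_cons, Finsupp.mapDomain_single, suffixSums_cons_congr]
      have hb : Finsupp.mapDomain suffixSums (barWord K (z :: l')) =
          Finsupp.single (suffixSums l') (1 : K) -
            Finsupp.mapDomain suffixSums (wordCons K z (barWord K l')) := by
        rw [barWord, ← Finsupp.lmapDomain_apply K K, map_sub, Finsupp.lmapDomain_apply,
          Finsupp.lmapDomain_apply, hm]
      rw [e, map_smul, simplicialBoundary_cone_single hnot, ih h4, map_smul, hcone, hb]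
      simp only [hl', List.length_cons]
      rcases neg_one_pow_eq_or K t.length with h | h <;> simp [pow_succ, h]

theorem simplicialBoundary_mapDomain_suffixSums {x : M} {n : ℕ} {X : List M →₀ K}
    (hX : X ∈ Finsupp.supported K K (wordsOfSum x (n + 1))) :
    simplicialBoundary K M (Finsupp.mapDomain suffixSums X) =
      Finsupp.mapDomain suffixSums (barDifferential K M (wordParity K M X)) := by
  refine LinearMap.eq_of_mem_supported
    (f := simplicialBoundary K M ∘ₗ Finsupp.lmapDomain K K suffixSums)
    (g := Finsupp.lmapDomain K K suffixSums ∘ₗ barDifferential K M ∘ₗ wordParity K M)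
    (fun l hl => ?_) hX
  simp only [LinearMap.comp_apply]
  rw [Finsupp.lmapDomain_apply, Finsupp.mapDomain_single, simplicialBoundary_suffixSums hl,
    wordParity_single, map_smul, map_smul, barDifferential_single, Finsupp.lmapDomain_apply]

/-- For nonzero letters the sum of the tail is the greatest proper suffix sum, so the chain
determines it. Cancellation then recovers the first letter, and induction the tail. -/
theorem suffixSums_injOn (x : M) (n : ℕ) : Set.InjOn suffixSums (wordsOfSum x n) := by
  intro l hl l' hl' h
  induction l generalizing x n l' with
  | nil =>
    obtain rfl : n = 0 := by simpa using hl.2.2.symm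
    exact (List.length_eq_zero_iff.1 hl'.2.2).symm
  | cons z l ih =>
    obtain ⟨h1, h2, h3⟩ := hl
    obtain ⟨h1', h2', h3'⟩ := hl'
    cases l' with
    | nil => rw [← h3'] at h3; simp at h3
    | cons z' l' =>
      simp only [List.mem_cons, forall_eq_or_imp, List.sum_cons, List.length_cons]
        at h1 h2 h3 h1' h2' h3'
      have hlen : l.length = l'.length := by omega
      cases l with
      | nil =>
        obtain rfl : l' = [] := List.length_eq_zero_iff.1 (by simpa using hlen.symm)
        simpa using h2.trans h2'.symm
      | cons b t =>
        have hne' : l' ≠ [] := by rintro rfl; simp at hlen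
        have hw : (b :: t) ∈ wordsOfSum (b :: t).sum (t.length + 1) := ⟨h1.2, rfl, by simp⟩
        have hw' : l' ∈ wordsOfSum l'.sum (t.length + 1) := ⟨h1'.2, rfl, by rw [← hlen]; simp⟩
        have c := (suffixSums_mem_chainsOfCard hw).2.1
        have c' := (suffixSums_mem_chainsOfCard hw').2.1
        rw [suffixSums_cons (List.cons_ne_nil b t), suffixSums_cons hne'] at h
        have hs : (b :: t).sum = l'.sum := by
          have m1 : (b :: t).sum ∈ insert l'.sum (suffixSums l') := h ▸ Finset.mem_insert_self _ _
          have m2 : l'.sum ∈ insert (b :: t).sum (suffixSums (b :: t)) :=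
            h ▸ Finset.mem_insert_self _ _
          rcases Finset.mem_insert.1 m1 with e | e
          · exact e
          rcases Finset.mem_insert.1 m2 with e' | e'
          · exact e'.symm
          · exact absurd ((c' e).2.trans (c e').2) (lt_irrefl _)
        have hs' : suffixSums (b :: t) = suffixSums l' := by
          have := congrArg (fun F => Finset.erase F (b :: t).sum) h
          rwa [Finset.erase_insert (fun h => lt_irrefl _ (c h).2), hs,
            Finset.erase_insert (fun h => lt_irrefl _ (c' h).2)] at this
        have hl := ih (b :: t).sum (t.length + 1) hw (hs ▸ hw') hs'
        rw [hl]
        congr 1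
        rw [hs, ← h2'] at h2
        exact add_right_cancel h2

/-- Restricting an open interval to the elements that do not have the full degree keeps homology
zero in a range in which it is zero. -/
theorem AcyclicBelow.sep_degree_lt {x : M} {k : ℕ} (h : AcyclicBelow K (Set.Ioo 0 x) k)
    (d : M →+ ℕ) (hx : d x ≠ 0) : AcyclicBelow K {y ∈ Set.Ioo 0 x | d y < d x} k := by
  have hx0 : x ≠ 0 := by rintro rfl; exact hx (map_zero d)
  rw [acyclicBelow_iff] at *
  intro n hn c hc hc0
  set A : Set (List M) := {l | l ∈ wordsOfSum x (n + 1) ∧ ∃ z t, l = z :: t ∧ d z ≠ 0}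
  have hsurj : ∀ m, Finsupp.supported K K (chainsOfCard (Set.Ioo 0 x) m) ≤
      (Finsupp.supported K K (wordsOfSum x (m + 1))).map (Finsupp.lmapDomain K K suffixSums) := by
    intro m
    rw [Finsupp.lmapDomain_supported]
    refine Finsupp.supported_mono fun F hF => ?_
    obtain ⟨z, l, hw, hs, -⟩ := exists_suffixSums_eq hx0 hF
    exact ⟨_, hw, hs⟩
  have hsurjA : Finsupp.supported K K (chainsOfCard {y ∈ Set.Ioo 0 x | d y < d x} n) ≤
      (Finsupp.supported K K A).map (Finsupp.lmapDomain K K suffixSums) := by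
    rw [Finsupp.lmapDomain_supported]
    refine Finsupp.supported_mono fun F hF => ?_
    obtain ⟨z, l, hw, hs, hz⟩ := exists_suffixSums_eq hx0
      (chainsOfCard_mono (Set.sep_subset _ _) n hF)
    refine ⟨_, ⟨hw, z, l, rfl, ?_⟩, hs⟩
    -- The first letter is x, or the difference of x and a chain element y with d y < d x; its
    -- degree is nonzero in both cases.
    rcases hz with rfl | ⟨y, hy, rfl⟩
    · exact hx
    · have := (hF.2.1 hy).2
      rw [map_add] at this
      omega
  obtain ⟨w, hw, hwc⟩ := h n hn c
    (Finsupp.supported_mono (chainsOfCard_mono (Set.sep_subset _ _) n) hc) hc0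
  obtain ⟨X, hX, rfl⟩ := hsurj _ hw
  obtain ⟨Y, hY, rfl⟩ := hsurjA hc
  have hτ : ∀ (s : Set (List M)) (Z : List M →₀ K), Z ∈ Finsupp.supported K K s →
      wordParity K M Z ∈ Finsupp.supported K K s := by
    intro s Z hZ
    refine LinearMap.mem_of_mem_supported (fun l hl => ?_) hZ
    rw [wordParity_single]
    exact Submodule.smul_mem _ _ (Finsupp.single_mem_supported K _ hl)
  have hBX : barDifferential K M (wordParity K M X) = Y := by
    have h1 : barDifferential K M (wordParity K M X) ∈
        Finsupp.supported K K (wordsOfSum x (n + 1)) := by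
      refine LinearMap.mem_of_mem_supported (fun l hl => ?_) (hτ _ _ hX)
      rw [barDifferential_single]
      exact barWord_mem_supported hl
    have h2 : Y ∈ Finsupp.supported K K (wordsOfSum x (n + 1)) :=
      Finsupp.supported_mono (fun l hl => hl.1) hY
    refine Finsupp.mapDomain_injOn (wordsOfSum x (n + 1)) (suffixSums_injOn x (n + 1))
      ((Finsupp.mem_supported K _).1 h1) ((Finsupp.mem_supported K _).1 h2) ?_
    rw [Finsupp.lmapDomain_apply, Finsupp.lmapDomain_apply] at hwc
    rw [← hwc, simplicialBoundary_mapDomain_suffixSums hX]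
  set ρ := retractProduct K d (Finsupp.single [] 1)
  have hρY : ρ Y = Y := by
    refine LinearMap.eq_of_mem_supported (f := ρ) (g := LinearMap.id) (fun l hl => ?_) hY
    obtain ⟨-, z, t, rfl, hz⟩ := hl
    rw [retractProduct_single, retractWord_nil_of_ne hz]
    rfl
  have hρX : ρ (wordParity K M X) ∈ Finsupp.supported K K
      {l | l ∈ wordsOfSum x (n + 1 + 1) ∧ ∃ z t, l = z :: t ∧ d z ≠ 0} := by
    refine LinearMap.mem_of_mem_supported (fun l hl => ?_) (hτ _ _ hX)
    rw [retractProduct_single]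
    refine Finsupp.supported_mono ?_ (retractWord_mem_supported d [] l)
    rintro w ⟨hp, hz⟩
    rw [List.nil_append] at hp
    exact ⟨⟨fun z hz => hl.1 z (hp.subset hz), hp.sum_eq.trans hl.2.1, hp.length_eq.trans hl.2.2⟩,
      hz⟩
  -- The chain map ρ fixes Y, so the image of a filling of Y is again a filling. The outer parity
  -- cancels the one in `simplicialBoundary_mapDomain_suffixSums`.
  set Z := wordParity K M (ρ (wordParity K M X))
  have hZ := hτ _ _ hρX
  refine ⟨Finsupp.lmapDomain K K suffixSums Z, ?_, ?_⟩
  · have := Submodule.mem_map_of_mem (f := Finsupp.lmapDomain K K suffixSums) hZ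
    rw [Finsupp.lmapDomain_supported] at this
    refine Finsupp.supported_mono ?_ this
    rintro _ ⟨l, ⟨hl, z, t, rfl, hz⟩, rfl⟩
    have hch := suffixSums_mem_chainsOfCard hl
    refine ⟨hch.1, fun y hy => ⟨hch.2.1 hy, ?_⟩, hch.2.2⟩
    -- Every suffix sum is at most the sum of the tail, which misses the nonzero degree of the first
    -- letter z.
    have hle : y ≤ t.sum := by
      cases t with
      | nil => simp [suffixSums] at hy
      | cons b t =>
        rw [suffixSums_cons (List.cons_ne_nil b t), Finset.coe_insert] at hy
        rcases hy with rfl | hy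
        · exact le_rfl
        · have hbt : (b :: t) ∈ wordsOfSum (b :: t).sum (t.length + 1) :=
            ⟨fun u hu => hl.1 u (List.mem_cons_of_mem _ hu), rfl, by simp⟩
          exact ((suffixSums_mem_chainsOfCard hbt).2.1 hy).2.le
    obtain ⟨u, hu⟩ := exists_add_of_le hle
    have h1 : d x = d z + (d y + d u) := by
      rw [← hl.2.1, List.sum_cons, map_add, hu, map_add]
    omega
  · rw [Finsupp.lmapDomain_apply, simplicialBoundary_mapDomain_suffixSums
      (Finsupp.supported_mono (fun l hl => hl.1) hZ), wordParity_wordParity,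
      barDifferential_retractProduct_nil, hBX, hρY, Finsupp.lmapDomain_apply]

end SuffixSums

/-! ### Selected bidegrees: vanishing ranges, links and Cohen–Macaulayness -/

section Selection

variable {K : Type*} [Field K] {M : Type*} [AddCommMonoid M] [PartialOrder M]
  [IsOrderedCancelAddMonoid M]

/-- Translation by an element as an order embedding. -/
def translation (y : M) : M ↪o M where
  toFun z := z + y
  inj' := add_left_injective y
  map_rel_iff' := add_le_add_iff_right y

variable [CanonicallyOrderedAdd M]

theorem translation_image (y w : M) (p : M → Prop) :
    translation y '' {z ∈ Set.Ioo 0 w | p (z + y)} = {z ∈ Set.Ioo y (w + y) | p z} := by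
  ext u
  constructor
  · rintro ⟨z, ⟨⟨h0, h1⟩, hp⟩, rfl⟩
    exact ⟨⟨lt_add_of_pos_left y h0, add_lt_add_left h1 y⟩, hp⟩
  · rintro ⟨⟨h0, h1⟩, hp⟩
    obtain ⟨z, rfl⟩ := exists_add_of_le h0.le
    refine ⟨z, ⟨⟨?_, ?_⟩, by rwa [add_comm]⟩, add_comm z y⟩
    · exact pos_of_lt_add_right h0
    · rw [add_comm] at h1
      exact lt_of_add_lt_add_right h1

/-- A family of bidegrees `D`, together with a function `m` that counts the elements of nonzero
degree in `D` on maximal chains. -/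
structure DegreeSelection where
  D : ℕ → ℕ → Prop
  m : ℕ → ℕ → ℕ
  m_zero : m 0 0 = 0
  -- Without subtraction: m grows at most as fast as the total degree.
  m_mono : ∀ {i j i' j'}, i ≤ i' → j ≤ j' → i + j + m i' j' ≤ i' + j' + m i j
  -- Outside D some entry can be lowered by one without lowering m and without losing any bidegree
  -- of D below (i, j).
  exists_side : ∀ {i j}, ¬D i j →
    (0 < i ∧ m i j ≤ m (i - 1) j ∧ ∀ i' j', i' ≤ i → j' ≤ j → D i' j' → i' < i) ∨
    (0 < j ∧ m i j ≤ m i (j - 1) ∧ ∀ i' j', i' ≤ i → j' ≤ j → D i' j' → j' < j)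
  D_add_iff : ∀ {i j i' j'}, D i j → (D (i' + i) (j' + j) ↔ D i' j')
  m_add : ∀ {i j i' j'}, D i j → D i' j' → m (i' + i) (j' + j) = m i' j' + m i j
  m_pos : ∀ {i j}, D i j → i + j ≠ 0 → 0 < m i j

/-- The elements whose degree lies in the selection. -/
def DegreeSelection.carrier (s : DegreeSelection) (d₁ d₂ : M →+ ℕ) : Set M :=
  {y | s.D (d₁ y) (d₂ y)}

theorem AddMonoidHom.map_le_of_le {M : Type*} [AddCommMonoid M] [PartialOrder M]
    [CanonicallyOrderedAdd M] (d : M →+ ℕ) {y x : M} (h : y ≤ x) : d y ≤ d x := by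
  obtain ⟨z, rfl⟩ := exists_add_of_le h
  rw [map_add]; omega

variable {s : DegreeSelection} {d₁ d₂ : M →+ ℕ}

/-- Deletion of the unselected elements from a down-closed part Q of (0, x). The link of y has a
selected lower part, controlled by `ih`, and a full upper part, controlled by `hup`; `hk` says that
the two ranges add up to at least k. -/
theorem AcyclicBelow.inter_carrier {M : Type*} [AddCommMonoid M] [PartialOrder M]
    {d₁ d₂ : M →+ ℕ} {x : M} {k : ℕ} {Q : Set M} (hfin : (Set.Iic x).Finite)
    (hQ : Q ⊆ Set.Ioo 0 x) (hlow : ∀ y ∈ Q, ∀ z, 0 < z → z < y → z ∈ Q) (h : AcyclicBelow K Q k)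
    (hup : ∀ y ∈ Q, AcyclicBelow K (Q ∩ Set.Ioi y) (d₁ x + d₂ x - (d₁ y + d₂ y) - 1))
    (hk : ∀ y ∈ Q, y ∉ s.carrier d₁ d₂ →
      k + (d₁ y + d₂ y) + 1 ≤ d₁ x + d₂ x + s.m (d₁ y) (d₂ y))
    (ih : ∀ y ∈ Q, y ∉ s.carrier d₁ d₂ →
      AcyclicBelow K (s.carrier d₁ d₂ ∩ Set.Ioo 0 y) (s.m (d₁ y) (d₂ y))) :
    AcyclicBelow K (Q ∩ s.carrier d₁ d₂) k := by
  refine h.inter_of_links (hfin.subset fun y hy => (hQ hy).2.le) fun y hy => ?_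
  refine ⟨s.m (d₁ y) (d₂ y), _, ?_, ?_, hup y hy.1⟩
  · have := hk y hy.1 hy.2
    omega
  · convert ih y hy.1 hy.2 using 1
    ext z
    constructor
    · rintro ⟨⟨h1, h2⟩, h3⟩
      exact ⟨h2, (hQ h1).1, h3⟩
    · rintro ⟨h2, h1, h3⟩
      exact ⟨⟨hlow y hy.1 z h1 h3, h2⟩, h3⟩

theorem acyclicBelow_Ioo_translate
    (hV : ∀ x : M, AcyclicBelow K (Set.Ioo 0 x) (d₁ x + d₂ x - 1)) {x y : M} (hyx : y < x) :
    AcyclicBelow K (Set.Ioo y x) (d₁ x + d₂ x - (d₁ y + d₂ y) - 1) := by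
  obtain ⟨w, rfl⟩ := exists_add_of_le hyx.le
  have h := (hV w).image (translation y)
  have e := translation_image y w (fun _ => True)
  simp only [and_true] at e
  change translation y '' Set.Ioo 0 w = Set.Ioo y (w + y) at e
  rw [e, add_comm w y] at h
  refine h.mono ?_
  simp only [map_add]
  omega

/-- The poset of all y in (0, x) with e y < e x contains every selected element, and deletion can
start there. Its parts above an element are translates of posets of the same kind, so
`AcyclicBelow.sep_degree_lt` serves both for the poset itself and for the upper links. -/
theorem acyclicBelow_carrier_of_side (hfin : ∀ x : M, (Set.Iic x).Finite)
    (hV : ∀ x : M, AcyclicBelow K (Set.Ioo 0 x) (d₁ x + d₂ x - 1)) {x : M} (e : M →+ ℕ)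
    (hx : e x ≠ 0)
    (hs : ∀ y < x, y ∈ s.carrier d₁ d₂ → e y < e x)
    {k : ℕ} (hk0 : k + 1 ≤ d₁ x + d₂ x)
    (hk : ∀ y < x, e y < e x → k + (d₁ y + d₂ y) + 1 ≤ d₁ x + d₂ x + s.m (d₁ y) (d₂ y))
    (ih : ∀ y < x, y ∉ s.carrier d₁ d₂ →
      AcyclicBelow K (s.carrier d₁ d₂ ∩ Set.Ioo 0 y) (s.m (d₁ y) (d₂ y))) :
    AcyclicBelow K (s.carrier d₁ d₂ ∩ Set.Ioo 0 x) k := by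
  have heq : s.carrier d₁ d₂ ∩ Set.Ioo 0 x =
      {y ∈ Set.Ioo 0 x | e y < e x} ∩ s.carrier d₁ d₂ := by
    ext y
    constructor
    · rintro ⟨h1, h2⟩
      exact ⟨⟨h2, hs y h2.2 h1⟩, h1⟩
    · rintro ⟨h1, h2⟩
      exact ⟨h2, h1.1⟩
  rw [heq]
  refine AcyclicBelow.inter_carrier (hfin x) (fun y hy => hy.1) ?_ ?_ ?_
    (fun y hy _ => hk y hy.1.2 hy.2) (fun y hy h => ih y hy.1.2 h)
  · exact fun y hy z h0 hz => ⟨⟨h0, hz.trans hy.1.2⟩, (e.map_le_of_le hz.le).trans_lt hy.2⟩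
  · exact ((hV x).sep_degree_lt e hx).mono (by omega)
  · intro y hy
    obtain ⟨w, rfl⟩ := exists_add_of_le hy.1.2.le
    have hw : e w ≠ 0 := by
      have := hy.2
      rw [map_add] at this
      omega
    have h := ((hV w).sep_degree_lt e hw).image (translation y)
    have e1 := translation_image y w (fun z => e z < e (y + w))
    have e2 : {z ∈ Set.Ioo 0 w | e (z + y) < e (y + w)} = {z ∈ Set.Ioo 0 w | e z < e w} := by
      ext z
      simp only [Set.mem_ofPred_eq, map_add]
      exact and_congr_right fun _ => by omega
    have e3 : {z ∈ Set.Ioo 0 (y + w) | e z < e (y + w)} ∩ Set.Ioi y =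
        {z ∈ Set.Ioo y (w + y) | e z < e (y + w)} := by
      ext z
      rw [add_comm w y]
      constructor
      · rintro ⟨⟨h1, h2⟩, h3⟩
        exact ⟨⟨h3, h1.2⟩, h2⟩
      · rintro ⟨h1, h2⟩
        exact ⟨⟨⟨hy.1.1.trans h1.1, h1.2⟩, h2⟩, h1.1⟩
    rw [e2] at e1
    rw [e3, ← e1]
    refine h.mono ?_
    simp only [map_add]
    omega

/-- The two claims are proved together: each deletion invokes the sharper bound for an unselected
element of smaller total degree. For selected x, deletion from (0, x) suffices because m grows at
most like the total degree. -/
theorem acyclicBelow_carrier (hd : ∀ x : M, d₁ x + d₂ x = 0 → x = 0)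
    (hfin : ∀ x : M, (Set.Iic x).Finite)
    (hV : ∀ x : M, AcyclicBelow K (Set.Ioo 0 x) (d₁ x + d₂ x - 1)) (x : M) :
    (x ∈ s.carrier d₁ d₂ →
      AcyclicBelow K (s.carrier d₁ d₂ ∩ Set.Ioo 0 x) (s.m (d₁ x) (d₂ x) - 1)) ∧
    (x ∉ s.carrier d₁ d₂ →
      AcyclicBelow K (s.carrier d₁ d₂ ∩ Set.Ioo 0 x) (s.m (d₁ x) (d₂ x))) := by
  induction hn : d₁ x + d₂ x using Nat.strong_induction_on generalizing x with
  | _ n ih =>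
  have hlt : ∀ y < x, d₁ y + d₂ y < d₁ x + d₂ x := by
    intro y hy
    obtain ⟨w, rfl⟩ := exists_add_of_le hy.le
    have hw : d₁ w + d₂ w ≠ 0 := fun h => hy.ne (by rw [hd w h, add_zero])
    simp only [map_add]
    omega
  have ih' : ∀ y < x, y ∉ s.carrier d₁ d₂ →
      AcyclicBelow K (s.carrier d₁ d₂ ∩ Set.Ioo 0 y) (s.m (d₁ y) (d₂ y)) := fun y hy =>
    (ih _ (hn ▸ hlt y hy) y rfl).2
  have hm0 := s.m_mono (Nat.zero_le (d₁ x)) (Nat.zero_le (d₂ x))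
  rw [s.m_zero] at hm0
  constructor
  · intro hx
    rw [Set.inter_comm]
    refine AcyclicBelow.inter_carrier (hfin x) subset_rfl
      (fun y hy z h0 hz => ⟨h0, hz.trans hy.2⟩) ((hV x).mono (by omega)) ?_ ?_
      (fun y hy => ih' y hy.2)
    · intro y hy
      have e : Set.Ioo 0 x ∩ Set.Ioi y = Set.Ioo y x := by
        ext z
        exact ⟨fun h => ⟨h.2, h.1.2⟩, fun h => ⟨⟨hy.1.trans h.1, h.2⟩, h.1⟩⟩
      rw [e]
      exact acyclicBelow_Ioo_translate hV hy.2
    · intro y hy _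
      have h1 := s.m_mono (d₁.map_le_of_le hy.2.le) (d₂.map_le_of_le hy.2.le)
      have h2 := hlt y hy.2
      omega
  · intro hx
    rcases s.exists_side hx with ⟨h0, hm, hs⟩ | ⟨h0, hm, hs⟩
    · refine acyclicBelow_carrier_of_side hfin hV d₁ h0.ne'
        (fun y hy hyD => hs _ _ (d₁.map_le_of_le hy.le) (d₂.map_le_of_le hy.le) hyD) ?_ ?_ ih'
      · have := s.m_mono (Nat.zero_le (d₁ x - 1)) (Nat.zero_le (d₂ x))
        rw [s.m_zero] at this
        omega
      · intro y hy hyx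
        -- Comparing y with the bidegree of x lowered by one, where m is no smaller, gains the
        -- missing unit.
        have := s.m_mono (show d₁ y ≤ d₁ x - 1 by omega) (d₂.map_le_of_le hy.le)
        omega
    · refine acyclicBelow_carrier_of_side hfin hV d₂ h0.ne'
        (fun y hy hyD => hs _ _ (d₁.map_le_of_le hy.le) (d₂.map_le_of_le hy.le) hyD) ?_ ?_ ih'
      · have := s.m_mono (Nat.zero_le (d₁ x)) (Nat.zero_le (d₂ x - 1))
        rw [s.m_zero] at this
        omega
      · intro y hy hyx
        have := s.m_mono (d₁.map_le_of_le hy.le) (show d₂ y ≤ d₂ x - 1 by omega)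
        omega

/-- The elements of `S` outside the chain `F` that are comparable with all elements of `F`. -/
def chainLink {P : Type*} [PartialOrder P] (S : Set P) (F : Finset P) : Set P :=
  {y ∈ S | ∀ z ∈ F, y < z ∨ z < y}

theorem simplicialLink_subsetOrderComplex {P : Type*} [PartialOrder P] {S : Set P} {F : Finset P}
    (hFS : (F : Set P) ⊆ S) (hF : IsChain (· ≤ ·) (F : Set P)) :
    simplicialLink (subsetOrderComplex S) F = subsetOrderComplex (chainLink S F) := by
  classical
  have key : ∀ G : Finset P, G ∈ (simplicialLink (subsetOrderComplex S) F).faces ↔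
      G ∈ (subsetOrderComplex (chainLink S F)).faces := by
    intro G
    constructor
    · rintro ⟨h1, h2, -, h3, h4⟩
      rw [Finset.coe_union] at h3 h4
      refine ⟨h1, fun y hy => ⟨h3 (Or.inl hy), fun z hz => ?_⟩, h4.mono Set.subset_union_left⟩
      have hne : y ≠ z := by
        rintro rfl
        exact Finset.disjoint_left.1 h2 hy hz
      rcases h4.total (Or.inl hy) (Or.inr hz) with h | h
      · exact Or.inl (lt_of_le_of_ne h hne)
      · exact Or.inr (lt_of_le_of_ne h hne.symm)
    · rintro ⟨h1, h2, h3⟩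
      refine ⟨h1, Finset.disjoint_left.2 fun y hy hz =>
        ((h2 hy).2 y hz).elim (lt_irrefl y) (lt_irrefl y), h1.mono Finset.subset_union_left, ?_, ?_⟩
      · rw [Finset.coe_union]
        exact Set.union_subset (fun y hy => (h2 hy).1) hFS
      · rw [Finset.coe_union, isChain_union]
        exact ⟨h3, hF, fun y hy z hz _ => ((h2 hy).2 z hz).imp le_of_lt le_of_lt⟩
  have hfaces : (simplicialLink (subsetOrderComplex S) F).faces =
      (subsetOrderComplex (chainLink S F)).faces := Set.ext key
  cases h : simplicialLink (subsetOrderComplex S) F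
  cases h' : subsetOrderComplex (chainLink S F)
  rw [h, h'] at hfaces
  simp only at hfaces
  subst hfaces
  rfl

theorem mem_carrier_add_iff {M : Type*} [AddCommMonoid M] {d₁ d₂ : M →+ ℕ} {y z : M}
    (hy : y ∈ s.carrier d₁ d₂) :
    z + y ∈ s.carrier d₁ d₂ ↔ z ∈ s.carrier d₁ d₂ := by
  unfold DegreeSelection.carrier
  rw [Set.mem_ofPred_eq, map_add, map_add]
  exact s.D_add_iff hy

/-- The successive differences along the chain from 0 to x are selected and nonzero, so each
contributes at least one to the additive function m. -/
theorem card_add_one_le_of_chain {M : Type*} [AddCommMonoid M] [PartialOrder M]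
    [CanonicallyOrderedAdd M] {d₁ d₂ : M →+ ℕ}
    (hd : ∀ x : M, d₁ x + d₂ x = 0 → x = 0) {x : M} (hx0 : x ≠ 0)
    (hx : x ∈ s.carrier d₁ d₂) {n : ℕ} {F : Finset M}
    (hF : F ∈ chainsOfCard (s.carrier d₁ d₂ ∩ Set.Ioo 0 x) n) : n + 1 ≤ s.m (d₁ x) (d₂ x) := by
  classical
  induction n generalizing x F with
  | zero => exact s.m_pos hx fun h => hx0 (hd x h)
  | succ n ih =>
    obtain ⟨y, hy, hmax⟩ := hF.2.2.exists_greatest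
      (Finset.card_pos.1 (by rw [hF.1]; exact n.succ_pos))
    obtain ⟨hyD, hy0, hyx⟩ := hF.2.1 hy
    have he := erase_mem_chainsOfCard hF hy
    have h1 := ih hy0.ne' hyD (F := F.erase y) ⟨he.1, fun u hu => ⟨(he.2.1 hu).1, (he.2.1 hu).2.1,
      lt_of_le_of_ne (hmax u (Finset.mem_of_mem_erase hu)) (Finset.ne_of_mem_erase hu)⟩, he.2.2⟩
    obtain ⟨w, rfl⟩ := exists_add_of_le hyx.le
    rw [add_comm] at hx
    have hw := (mem_carrier_add_iff hyD).1 hx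
    have hw0 : 0 < s.m (d₁ w) (d₂ w) := s.m_pos hw fun h => hyx.ne (by rw [hd w h, add_zero])
    have h2 := s.m_add hyD hw
    rw [add_comm y w, map_add, map_add]
    omega

/-- The greatest element y of F splits the link into the link of the rest of F below y and the
selected part of (y, x). The latter is a translate of a selected interval (0, w) with y + w = x, and
m(x) = m(y) + m(w). -/
theorem acyclicBelow_chainLink (hd : ∀ x : M, d₁ x + d₂ x = 0 → x = 0)
    (hfin : ∀ x : M, (Set.Iic x).Finite)
    (hV : ∀ x : M, AcyclicBelow K (Set.Ioo 0 x) (d₁ x + d₂ x - 1)) {x : M}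
    (hx : x ∈ s.carrier d₁ d₂) {n : ℕ} {F : Finset M}
    (hF : F ∈ chainsOfCard (s.carrier d₁ d₂ ∩ Set.Ioo 0 x) n) {k : ℕ}
    (hk : k + n + 1 ≤ s.m (d₁ x) (d₂ x)) :
    AcyclicBelow K (chainLink (s.carrier d₁ d₂ ∩ Set.Ioo 0 x) F) k := by
  classical
  induction n generalizing x F k with
  | zero =>
    have : chainLink (s.carrier d₁ d₂ ∩ Set.Ioo 0 x) F = s.carrier d₁ d₂ ∩ Set.Ioo 0 x := by
      rw [Finset.card_eq_zero.1 hF.1]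
      exact Set.Subset.antisymm (Set.sep_subset _ _) fun z hz => ⟨hz, by simp⟩
    rw [this]
    exact ((acyclicBelow_carrier hd hfin hV x).1 hx).mono (by omega)
  | succ n ih =>
    obtain ⟨y, hy, hmax⟩ := hF.2.2.exists_greatest
      (Finset.card_pos.1 (by rw [hF.1]; exact n.succ_pos))
    obtain ⟨hyD, hy0, hyx⟩ := hF.2.1 hy
    have he := erase_mem_chainsOfCard hF hy
    have he' : F.erase y ∈ chainsOfCard (s.carrier d₁ d₂ ∩ Set.Ioo 0 y) n :=
      ⟨he.1, fun u hu => ⟨(he.2.1 hu).1, (he.2.1 hu).2.1,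
      lt_of_le_of_ne (hmax u (Finset.mem_of_mem_erase hu)) (Finset.ne_of_mem_erase hu)⟩, he.2.2⟩
    -- Needed so that the truncated subtraction m(y) - n - 1 below is a true one.
    have hyc := card_add_one_le_of_chain hd hy0.ne' hyD he'
    obtain ⟨w, rfl⟩ := exists_add_of_le hyx.le
    rw [add_comm y w] at hx hF hk hyx ⊢
    have hw := (mem_carrier_add_iff hyD).1 hx
    have hlower := ih hyD he' (k := s.m (d₁ y) (d₂ y) - n - 1) (by omega)
    have hupper := ((acyclicBelow_carrier hd hfin hV w).1 hw).image (translation y)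
    have e1 : s.carrier d₁ d₂ ∩ Set.Ioo 0 w = {z ∈ Set.Ioo 0 w | z + y ∈ s.carrier d₁ d₂} := by
      ext z
      rw [Set.mem_ofPred_eq, mem_carrier_add_iff hyD]
      exact and_comm
    rw [e1, translation_image y w (· ∈ s.carrier d₁ d₂)] at hupper
    have hun := hlower.union hupper fun a ha b hb => ha.1.2.2.trans hb.1.1
    have hm := s.m_add hyD hw
    rw [map_add, map_add] at hk
    have hk' : k ≤ s.m (d₁ y) (d₂ y) - n - 1 + (s.m (d₁ w) (d₂ w) - 1) := by
      rcases Nat.eq_zero_or_pos (s.m (d₁ w) (d₂ w)) with h0 | h0 <;> omega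
    convert hun.mono hk' using 1
    ext z
    constructor
    · rintro ⟨⟨hz, hz0, hzx⟩, hcmp⟩
      rcases hcmp y hy with h | h
      · exact Or.inl ⟨⟨hz, hz0, h⟩, fun u hu => hcmp u (Finset.mem_of_mem_erase hu)⟩
      · exact Or.inr ⟨⟨h, hzx⟩, hz⟩
    · rintro (⟨⟨hz, hz0, hzy⟩, hcmp⟩ | ⟨⟨hyz, hzx⟩, hz⟩)
      · refine ⟨⟨hz, hz0, hzy.trans hyx⟩, fun u hu => ?_⟩
        rcases eq_or_ne u y with rfl | hne
        · exact Or.inl hzy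
        · exact hcmp u (Finset.mem_erase.2 ⟨hne, hu⟩)
      · exact ⟨⟨hz, hy0.trans hyz, hzx⟩, fun u hu => Or.inr ((hmax u hu).trans_lt hyz)⟩

/-- A face G of the link makes G ∪ F a chain, so |G| + |F| + 1 ≤ m(x). The dimension of the link is
thereby bounded by the range in `acyclicBelow_chainLink`. -/
theorem isCohenMacaulayComplex_carrier (hd : ∀ x : M, d₁ x + d₂ x = 0 → x = 0)
    (hfin : ∀ x : M, (Set.Iic x).Finite)
    (hV : ∀ x : M, AcyclicBelow K (Set.Ioo 0 x) (d₁ x + d₂ x - 1)) {x : M}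
    (hx : x ∈ s.carrier d₁ d₂) :
    IsCohenMacaulayComplex K (subsetOrderComplex (s.carrier d₁ d₂ ∩ Set.Ioo 0 x)) := by
  classical
  intro F hF n hG
  have hF' : F ∈ chainsOfCard (s.carrier d₁ d₂ ∩ Set.Ioo 0 x) F.card := by
    rcases hF with hF | rfl
    · exact ⟨rfl, hF.2⟩
    · exact ⟨rfl, by simp, by simp⟩
  obtain ⟨G, ⟨hG0, hdisj, -, hGF⟩, hn⟩ := hG
  have hx0 : x ≠ 0 := by
    obtain ⟨y, hy⟩ := hG0
    have := (hGF.1 (Finset.mem_coe.2 (Finset.mem_union_left F hy))).2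
    exact (this.1.trans this.2).ne'
  have hcard := card_add_one_le_of_chain hd hx0 hx (n := G.card + F.card)
    ⟨Finset.card_union_of_disjoint hdisj, by convert hGF.1, by convert hGF.2⟩
  rw [simplicialLink_subsetOrderComplex hF'.2.1 hF'.2.2]
  exact acyclicBelow_chainLink hd hfin hV hx hF' (k := n + 1) (by omega) n n.lt_succ_self

theorem exists_chain_of_pred {M : Type*} [AddCommMonoid M] [PartialOrder M]
    [CanonicallyOrderedAdd M]
    {d : M →+ ℕ} (hpred : ∀ x : M, x ≠ 0 → ∃ y < x, d y + 1 = d x)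
    {x : M} (hx : x ≠ 0) : ∃ F, F ∈ chainsOfCard (Set.Ioo 0 x) (d x - 1) := by
  classical
  induction hn : d x generalizing x with
  | zero =>
    obtain ⟨y, -, hy⟩ := hpred x hx
    omega
  | succ n ih =>
    obtain ⟨y, hyx, hy⟩ := hpred x hx
    rcases eq_or_ne y 0 with rfl | hy0
    · rw [map_zero] at hy
      obtain rfl : n = 0 := by omega
      exact ⟨∅, rfl, by simp, by simp⟩
    · obtain ⟨F, h1, h2, h3⟩ := ih hy0 (by omega)
      obtain ⟨z, -, hz⟩ := hpred y hy0
      refine ⟨insert y F, ?_, ?_, ?_⟩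
      · rw [Finset.card_insert_of_notMem (fun h => lt_irrefl _ (h2 h).2), h1]
        omega
      · rw [Finset.coe_insert, Set.insert_subset_iff]
        exact ⟨⟨pos_iff_ne_zero.2 hy0, hyx⟩, fun u hu => ⟨(h2 hu).1, (h2 hu).2.trans hyx⟩⟩
      · rw [Finset.coe_insert]
        exact h3.insert fun u hu _ => Or.inr (h2 hu).2.le

/-- Descending by steps of degree one yields a chain with d x - 1 elements. The dimension is thus at
least d x - 2, and Cohen–Macaulayness at the empty face gives the range. -/
theorem acyclicBelow_of_isCohenMacaulayComplex {M : Type*} [AddCommMonoid M]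
    [PartialOrder M] [CanonicallyOrderedAdd M] {d : M →+ ℕ}
    (hpred : ∀ x : M, x ≠ 0 → ∃ y < x, d y + 1 = d x) {x : M}
    (h : IsCohenMacaulayComplex K (subsetOrderComplex (Set.Ioo 0 x))) :
    AcyclicBelow K (Set.Ioo 0 x) (d x - 1) := by
  classical
  intro n hn
  have hx : x ≠ 0 := by
    rintro rfl
    rw [map_zero] at hn
    exact absurd hn (Nat.not_lt_zero n)
  obtain ⟨F, hF⟩ := exists_chain_of_pred hpred hx
  have hlink : simplicialLink (subsetOrderComplex (Set.Ioo 0 x)) ∅ =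
      subsetOrderComplex (Set.Ioo 0 x) := by
    rw [simplicialLink_subsetOrderComplex (by simp) (by simp)]
    congr 1
    exact Set.Subset.antisymm (Set.sep_subset _ _) fun z hz => ⟨hz, by simp⟩
  have := h ∅ (Or.inr rfl) n
  rw [hlink] at this
  refine this ⟨F, ⟨Finset.card_pos.1 (by rw [hF.1]; omega), hF.2⟩, by rw [hF.1]; exact hn⟩

end Selection

/-! ### The two selections of bidegrees -/

section Degrees

theorem Nat.add_div_le_add_div_of_le (a : ℕ) {i i' : ℕ} (h : i ≤ i') :
    i + i' / a ≤ i' + i / a := by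
  induction i', h using Nat.le_induction with
  | base => exact le_rfl
  | succ k hk ih =>
    rw [Nat.succ_div]
    split_ifs <;> omega

/-- The bidegrees in which the first entry is a multiple of `a` and the second one a multiple of
`b`. -/
def DegreeSelection.veronese (a b : ℕ) : DegreeSelection where
  D i j := a ∣ i ∧ b ∣ j
  -- For a = 0 divisibility forces i = 0, and the convention i / 0 = 0 is then the right count;
  -- likewise for b.
  m i j := i / a + j / b
  m_zero := by simp
  m_mono {i j i' j'} hi hj := by
    have h1 := Nat.add_div_le_add_div_of_le a hi
    have h2 := Nat.add_div_le_add_div_of_le b hj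
    omega
  exists_side {i j} h := by
    have key : ∀ c k : ℕ, ¬c ∣ k → 0 < k ∧ k / c ≤ (k - 1) / c := by
      intro c k hk
      cases k with
      | zero => exact absurd (dvd_zero c) hk
      | succ k => exact ⟨k.succ_pos, by rw [Nat.succ_div_of_not_dvd hk]; simp⟩
    by_cases hi : a ∣ i
    · have hj : ¬b ∣ j := fun hj => h ⟨hi, hj⟩
      refine Or.inr ⟨(key b j hj).1, Nat.add_le_add_left (key b j hj).2 _, ?_⟩
      rintro i' j' - hj' ⟨-, h'⟩
      exact lt_of_le_of_ne hj' (by rintro rfl; exact hj h')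
    · refine Or.inl ⟨(key a i hi).1, Nat.add_le_add_right (key a i hi).2 _, ?_⟩
      rintro i' j' hi' - ⟨h', -⟩
      exact lt_of_le_of_ne hi' (by rintro rfl; exact hi h')
  D_add_iff {i j i' j'} h := by rw [Nat.dvd_add_left h.1, Nat.dvd_add_left h.2]
  m_add {i j i' j'} h _ := by
    rw [Nat.add_div_of_dvd_left h.1, Nat.add_div_of_dvd_left h.2]
    omega
  m_pos {i j} h h0 := by
    have key : ∀ c k : ℕ, c ∣ k → k ≠ 0 → 0 < k / c := fun c k hc hk =>
      Nat.div_pos (Nat.le_of_dvd (Nat.pos_of_ne_zero hk) hc)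
        (Nat.pos_of_dvd_of_pos hc (Nat.pos_of_ne_zero hk))
    by_cases hi : i = 0
    · exact Nat.add_pos_right _ (key b j h.2 (by omega))
    · exact Nat.add_pos_left (key a i h.1 hi) _

/-- The multiples of the bidegree `(a, b)`. -/
def DegreeSelection.diagonal {a b : ℕ} (ha : 0 < a) (hb : 0 < b) : DegreeSelection where
  D i j := ∃ k, i = k * a ∧ j = k * b
  m i j := min (i / a) (j / b)
  m_zero := by simp
  m_mono {i j i' j'} hi hj := by
    have h1 := Nat.add_div_le_add_div_of_le a hi
    have h2 := Nat.add_div_le_add_div_of_le b hj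
    omega
  exists_side {i j} h := by
    have hi : min (i / a) (j / b) * a ≤ i := (Nat.le_div_iff_mul_le ha).1 (min_le_left _ _)
    have hj : min (i / a) (j / b) * b ≤ j := (Nat.le_div_iff_mul_le hb).1 (min_le_right _ _)
    have hle : ∀ k, k * a ≤ i → k * b ≤ j → k ≤ min (i / a) (j / b) := fun k h1 h2 =>
      le_min ((Nat.le_div_iff_mul_le ha).2 h1) ((Nat.le_div_iff_mul_le hb).2 h2)
    -- If i exceeds the first entry of the largest multiple of (a, b) below (i, j), the first entry
    -- can be lowered. Otherwise j exceeds the second entry, because (i, j) is not a multiple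
    -- itself.
    rcases hi.lt_or_eq with hlt | heq
    · refine Or.inl ⟨by omega, le_min ((Nat.le_div_iff_mul_le ha).2 (by omega))
        (min_le_right _ _), ?_⟩
      rintro _ _ h1 h2 ⟨k, rfl, rfl⟩
      exact (Nat.mul_le_mul_right a (hle k h1 h2)).trans_lt hlt
    · have hlt : min (i / a) (j / b) * b < j := lt_of_le_of_ne hj fun e => h ⟨_, heq.symm, e.symm⟩
      refine Or.inr ⟨by omega, le_min (min_le_left _ _)
        ((Nat.le_div_iff_mul_le hb).2 (by omega)), ?_⟩
      rintro _ _ h1 h2 ⟨k, rfl, rfl⟩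
      exact (Nat.mul_le_mul_right b (hle k h1 h2)).trans_lt hlt
  D_add_iff {i j i' j'} h := by
    obtain ⟨k, rfl, rfl⟩ := h
    constructor
    · rintro ⟨l, h1, h2⟩
      refine ⟨l - k, ?_, ?_⟩
      · rw [Nat.sub_mul]; omega
      · rw [Nat.sub_mul]; omega
    · rintro ⟨l, rfl, rfl⟩
      exact ⟨l + k, (add_mul _ _ _).symm, (add_mul _ _ _).symm⟩
  m_add {i j i' j'} h h' := by
    obtain ⟨k, rfl, rfl⟩ := h
    obtain ⟨l, rfl, rfl⟩ := h'
    simp only [← add_mul, Nat.mul_div_cancel _ ha, Nat.mul_div_cancel _ hb, min_self]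
  m_pos {i j} h h0 := by
    obtain ⟨k, rfl, rfl⟩ := h
    simp only [Nat.mul_div_cancel _ ha, Nat.mul_div_cancel _ hb, min_self]
    exact Nat.pos_of_ne_zero (by rintro rfl; simp at h0)

end Degrees

/-! ### The semigroup as an ordered cancellative monoid with a bidegree -/

namespace StandardBigradedSemigroup

variable {d : ℕ} (Λ : StandardBigradedSemigroup d)

instance : Add Λ.Elem := ⟨fun x y => ⟨x.1 + y.1, Λ.toAddSubmonoid.add_mem x.2 y.2⟩⟩

instance : AddCommMonoid Λ.Elem where
  add_assoc x y z := Subtype.ext (add_assoc x.1 y.1 z.1)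
  zero_add x := Subtype.ext (zero_add x.1)
  add_zero x := Subtype.ext (add_zero x.1)
  add_comm x y := Subtype.ext (add_comm x.1 y.1)
  nsmul := nsmulRec

variable {Λ}

theorem Elem.val_add (x y : Λ.Elem) : (x + y).1 = x.1 + y.1 := rfl

theorem Elem.le_iff_exists_add {x y : Λ.Elem} : x ≤ y ↔ ∃ z : Λ.Elem, y = x + z := by
  constructor
  · rintro ⟨σ, hσ, h⟩
    exact ⟨⟨σ, hσ⟩, Subtype.ext (h.trans (add_comm _ _))⟩
  · rintro ⟨z, rfl⟩
    exact ⟨z.1, z.2, add_comm _ _⟩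

theorem Elem.add_le_add_left_iff {x y z : Λ.Elem} : z + x ≤ z + y ↔ x ≤ y := by
  rw [le_iff_exists_add, le_iff_exists_add]
  refine exists_congr fun u => ⟨fun h => Subtype.ext ?_, fun h => by rw [h, add_assoc]⟩
  have := congrArg Subtype.val h
  rw [val_add, val_add, val_add, add_assoc] at this
  exact add_left_cancel this

instance : IsOrderedCancelAddMonoid Λ.Elem where
  add_le_add_left x y h z := by
    rw [add_comm x, add_comm y]
    exact Elem.add_le_add_left_iff.2 h
  le_of_add_le_add_left z x y h := Elem.add_le_add_left_iff.1 h

instance : CanonicallyOrderedAdd Λ.Elem where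
  exists_add_of_le h := Elem.le_iff_exists_add.1 h
  le_add_self x y := Elem.le_iff_exists_add.2 ⟨y, add_comm y x⟩
  le_self_add _ y := Elem.le_iff_exists_add.2 ⟨y, rfl⟩

theorem Elem.exists_mem_component (x : Λ.Elem) :
    ∃ p : ℕ × ℕ, x.1 ∈ Λ.component p.1 p.2 := by
  have : x.1 ∈ (⋃ i, ⋃ j, Λ.component i j) := by
    rw [Λ.iUnion_component]; exact x.2
  simp only [Set.mem_iUnion] at this
  obtain ⟨i, j, h⟩ := this
  exact ⟨(i, j), h⟩

/-- The bidegree of an element. -/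
noncomputable def Elem.bidegree (x : Λ.Elem) : ℕ × ℕ := x.exists_mem_component.choose

theorem Elem.bidegree_eq_iff {x : Λ.Elem} {i j : ℕ} :
    x.1 ∈ Λ.component i j ↔ x.bidegree = (i, j) := by
  have hx := x.exists_mem_component.choose_spec
  constructor
  · intro h
    by_contra hne
    exact Set.disjoint_left.1 (Λ.disjoint_component _ _ _ _ hne) hx h
  · intro h
    unfold bidegree at h
    rwa [h] at hx

theorem Elem.bidegree_add (x y : Λ.Elem) : (x + y).bidegree = x.bidegree + y.bidegree :=
  bidegree_eq_iff.1 (Λ.add_mem_component _ _ _ _ _ _ (bidegree_eq_iff.2 rfl)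
    (bidegree_eq_iff.2 rfl))

theorem Elem.bidegree_eq_zero_iff {x : Λ.Elem} : x.bidegree = 0 ↔ x = 0 := by
  have h := bidegree_eq_iff (x := x) (i := 0) (j := 0)
  rw [Λ.component_zero_zero, Set.mem_singleton_iff] at h
  exact h.symm.trans ⟨fun h => Subtype.ext h, fun h => congrArg Subtype.val h⟩

variable (Λ)

/-- The first entry of the bidegree. -/
noncomputable def degreeFst : Λ.Elem →+ ℕ where
  toFun x := x.bidegree.1
  map_zero' := congrArg Prod.fst (Elem.bidegree_eq_zero_iff.2 rfl)
  map_add' x y := congrArg Prod.fst (Elem.bidegree_add x y)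

/-- The second entry of the bidegree. -/
noncomputable def degreeSnd : Λ.Elem →+ ℕ where
  toFun x := x.bidegree.2
  map_zero' := congrArg Prod.snd (Elem.bidegree_eq_zero_iff.2 rfl)
  map_add' x y := congrArg Prod.snd (Elem.bidegree_add x y)

variable {Λ}

theorem mem_component_iff {x : Λ.Elem} {i j : ℕ} :
    x.1 ∈ Λ.component i j ↔ Λ.degreeFst x = i ∧ Λ.degreeSnd x = j :=
  Elem.bidegree_eq_iff.trans Prod.ext_iff

theorem eq_zero_of_degree {x : Λ.Elem} (h : Λ.degreeFst x + Λ.degreeSnd x = 0) : x = 0 :=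
  Elem.bidegree_eq_zero_iff.1 (Prod.ext (Nat.eq_zero_of_add_eq_zero_right h)
    (Nat.eq_zero_of_add_eq_zero_left h))

/-- Divisibility implies the componentwise order of ℕ ^ d, where lower sets of points are finite. -/
theorem finite_Iic (x : Λ.Elem) : (Set.Iic x).Finite := by
  have hinj : Function.Injective (fun y : Λ.Elem => y.1) := Subtype.val_injective
  refine Set.Finite.of_finite_image ((Set.finite_Iic x.1).subset ?_) hinj.injOn
  rintro _ ⟨y, ⟨σ, -, h⟩, rfl⟩
  intro i
  have := congrFun h i
  simp only [Pi.add_apply] at this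
  show y.1 i ≤ x.1 i
  omega

/-- A nonzero element is a sum of generators, and splitting one off lowers the total degree by
exactly one. -/
theorem exists_pred (x : Λ.Elem) (hx : x ≠ 0) : ∃ y < x,
    (Λ.degreeFst + Λ.degreeSnd) y + 1 = (Λ.degreeFst + Λ.degreeSnd) x := by
  have key : ∀ v ∈ AddSubmonoid.closure (Λ.component 1 0 ∪ Λ.component 0 1), v = 0 ∨
      ∃ g ∈ Λ.component 1 0 ∪ Λ.component 0 1, ∃ w ∈ Λ.toAddSubmonoid, v = g + w := by
    intro v hv
    refine AddSubmonoid.closure_induction ?_ ?_ ?_ hv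
    · exact fun g hg => Or.inr ⟨g, hg, 0, Λ.toAddSubmonoid.zero_mem, (add_zero g).symm⟩
    · exact Or.inl rfl
    · rintro u v - hv (rfl | ⟨g, hg, w, hw, rfl⟩) hv'
      · rwa [zero_add]
      · rw [Λ.closure_component] at hv
        exact Or.inr ⟨g, hg, w + v, Λ.toAddSubmonoid.add_mem hw hv, add_assoc _ _ _⟩
  rcases key x.1 (by rw [Λ.closure_component]; exact x.2) with h | ⟨g, hg, w, hw, h⟩
  · exact absurd (Subtype.ext h) hx
  have hgΛ : g ∈ Λ.toAddSubmonoid := by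
    rw [← Λ.closure_component]
    exact AddSubmonoid.subset_closure hg
  let g' : Λ.Elem := ⟨g, hgΛ⟩
  let w' : Λ.Elem := ⟨w, hw⟩
  obtain rfl : x = g' + w' := Subtype.ext h
  have hdeg : (Λ.degreeFst + Λ.degreeSnd) g' = 1 := by
    rw [AddMonoidHom.add_apply]
    rcases hg with hg | hg
    · have := mem_component_iff (x := g').1 hg
      omega
    · have := mem_component_iff (x := g').1 hg
      omega
  refine ⟨w', ?_, by rw [map_add, hdeg, add_comm]⟩
  refine lt_add_of_ne_zero_left (fun h0 => ?_) w'
  rw [h0, map_zero] at hdeg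
  exact absurd hdeg (by norm_num)

theorem veronese_eq_carrier (a b : ℕ) :
    Λ.veronese a b = (DegreeSelection.veronese a b).carrier Λ.degreeFst Λ.degreeSnd := by
  ext x
  constructor
  · rintro ⟨i, j, h⟩
    obtain ⟨h1, h2⟩ := mem_component_iff.1 h
    exact ⟨h1 ▸ dvd_mul_left a i, h2 ▸ dvd_mul_left b j⟩
  · rintro ⟨⟨i, hi⟩, ⟨j, hj⟩⟩
    exact ⟨i, j, mem_component_iff.2 ⟨hi.trans (mul_comm _ _), hj.trans (mul_comm _ _)⟩⟩

theorem diagonal_eq_carrier {a b : ℕ} (ha : 0 < a) (hb : 0 < b) :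
    Λ.diagonal a b = (DegreeSelection.diagonal ha hb).carrier Λ.degreeFst Λ.degreeSnd := by
  ext x
  exact exists_congr fun i => mem_component_iff

/-- The index multiplied by zero is irrelevant, so it can be set equal to the other one. -/
theorem diagonal_eq_veronese {a b : ℕ} (h : a = 0 ∨ b = 0) :
    Λ.diagonal a b = Λ.veronese a b := by
  ext x
  constructor
  · rintro ⟨i, hi⟩
    exact ⟨i, i, hi⟩
  · rintro ⟨i, j, hij⟩
    rcases h with rfl | rfl
    · exact ⟨j, by simpa using hij⟩
    · exact ⟨i, by simpa using hij⟩

end StandardBigradedSemigroup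

open StandardBigradedSemigroup in
theorem mainTheorem11 (K : Type*) [Field K] {d : ℕ} (Λ : StandardBigradedSemigroup d)
    (a b : ℕ) (hab : (a, b) ≠ (0, 0))
    (hCM : ∀ ν : Λ.Elem, IsCohenMacaulayComplex K (subsetOrderComplex (Set.Ioo 0 ν))) :
    (∀ ν ∈ Λ.diagonal a b,
      IsCohenMacaulayComplex K (subsetOrderComplex (Λ.diagonal a b ∩ Set.Ioo 0 ν))) ∧
    (∀ ν ∈ Λ.veronese a b,
      IsCohenMacaulayComplex K (subsetOrderComplex (Λ.veronese a b ∩ Set.Ioo 0 ν))) := by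
  have hV : ∀ x : Λ.Elem, AcyclicBelow K (Set.Ioo 0 x) (Λ.degreeFst x + Λ.degreeSnd x - 1) :=
    fun x => acyclicBelow_of_isCohenMacaulayComplex (d := Λ.degreeFst + Λ.degreeSnd)
      exists_pred (hCM x)
  have hcarrier : ∀ s : DegreeSelection, ∀ ν ∈ s.carrier Λ.degreeFst Λ.degreeSnd,
      IsCohenMacaulayComplex K
        (subsetOrderComplex (s.carrier Λ.degreeFst Λ.degreeSnd ∩ Set.Ioo 0 ν)) :=
    fun s ν hν => isCohenMacaulayComplex_carrier (fun x => eq_zero_of_degree) finite_Iic hV hν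
  have hver : ∀ ν ∈ Λ.veronese a b,
      IsCohenMacaulayComplex K (subsetOrderComplex (Λ.veronese a b ∩ Set.Ioo 0 ν)) := by
    rw [veronese_eq_carrier]
    exact hcarrier _
  refine ⟨?_, hver⟩
  by_cases h : a = 0 ∨ b = 0
  · rw [diagonal_eq_veronese h]
    exact hver
  · rw [not_or] at h
    rw [diagonal_eq_carrier (Nat.pos_of_ne_zero h.1) (Nat.pos_of_ne_zero h.2)]
    exact hcarrier _
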